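/- **Setting.** Let $\Delta$ be an irreducible reduced crystallographic root system in a real vector space $\mathfrak h_{\mathbb R}^*$, identified with its dual $\mathfrak h_{\mathbb R}$ by a Weyl-group-invariant inner product, $W$ its Weyl group and $s\in W$. Write $$s=s^1s^2,\qquad s^1=s_{\gamma_1}\cdots s_{\gamma_n},\quad s^2=s_{\gamma_{n+1}}\cdots s_{\gamma_{l'}}\qquad(*)$$ where the roots in each of the sets $\{\gamma_1,\dots,\gamma_n\}$, $\{\gamma_{n+1},\dots,\gamma_{l'}\}$ are mutually orthogonal and $\gamma_1,\dots,\gamma_{l'}$ form a basis of the orthogonal complement of the fixed space of $s$ (the signs of the roots $\gamma_i$ are arbitrary). **Positive systems associated to $s$.** For a presentation $s=s^1s^2$ of the form $(*)$ let $\mathfrak h_{\mathbb R}=\bigoplus_{i=0}^K\mathfrak h_i$ be an orthogonal decomposition into subspaces invariant under $s^1$ and $s^2$, where $\mathfrak h_0$ is the fixed space of $s$ and, for $i\ge1$, $\mathfrak h_i$ is either a plane on which $s$ is a rotation by an angle $\theta_i\in(0,\pi)$, or a line on which $s=-1$ (put $\theta_i=\pi$); the summands are ordered so that $\theta_1\ge\theta_2\ge\dots\ge\theta_K$.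 Choose $h_i\in\mathfrak h_i$ with $h_i(\alpha)\ne0$ for every root $\alpha$ not orthogonal to $\mathfrak h_i$, and put $\overline\Delta_i=\{\alpha\in\Delta: h_j(\alpha)=0 \text{ for } j>i,\ h_i(\alpha)\neq0\}$. Let $I$ be the set of indices $i$ with $\overline\Delta_i\ne\emptyset$, and assume that $|h_i(\alpha)|>\bigl|\sum_{j\in I,\,p\le j<i}h_j(\alpha)\bigr|$ for all $\alpha\in\overline\Delta_i$ and $p<i$. Then $\Delta_+=\{\alpha\in\Delta:\sum_{i\in I}h_i(\alpha)>0\}$ is called a system of positive roots associated to $s$. Let $\alpha_1,\dots,\alpha_l$ be its simple roots, $a_{ij}=\langle\alpha_j,\alpha_i^\vee\rangle$, let $d_1,\dots,d_l$ be the coprime positive integers for which the matrix $(d_ia_{ij})$ is symmetric, and define linear functionals $Y_j$ by $Y_j(\alpha_i)=d_i\delta_{ij}$. **The classes considered and the number $q$.** If $\Delta$ is of classical type $A_l$, $B_l$, $C_l$ or $D_l$, then $s\in W$ is arbitrary and $q$ is not defined. If $\Delta$ is of exceptional type, then $s=1$ (and $q$ is not defined) or $s$ belongs to one of the following conjugacy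 classes (in Carter's notation), where an upper index in square brackets is the value of $q$, and $q$ is not defined for the classes without one. A tilde denotes short roots; where Carter's symbol denotes two classes in type $E_7$ or $E_8$, an index $\langle f\rangle$ gives the number $f$ of roots fixed by the elements of the class meant. * $G_2$: $A_1^{[3]}$, $\tilde A_1$, $(A_1+\tilde A_1)^{[3]}$, $A_2^{[3]}$, $G_2^{[3]}$. * $F_4$: $A_1$, $\tilde A_1$, $2A_1$ (two long roots), $4A_1$, $A_2$, $\tilde A_2$, $B_2$, $A_2+\tilde A_1$, $\tilde A_2+A_1$, $(A_2+\tilde A_2)^{[3]}$, $A_3$, $B_2+A_1$, $A_3+\tilde A_1$, $D_4(a_1)$, $D_4$, $C_3+A_1$, $F_4(a_1)$, $B_4$, $F_4$. * $E_6$: $A_1$, $2A_1$, $4A_1$, $A_2$, $A_2+A_1$, $2A_2$, $A_2+2A_1$, $A_3$, $3A_2^{[3]}$, $A_3+2A_1$, $D_4(a_1)$, $A_4$, $D_4$, $A_4+A_1$, $A_5+A_1$, $D_5(a_1)$, $E_6(a_2)$, $D_5$, $E_6(a_1)$, $E_6$. * $E_7$: $A_1$, $2A_1$, $3A_1\langle24\rangle$,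 $4A_1$ (both classes), $A_2$, $7A_1$, $A_2+A_1$, $A_2+2A_1$, $A_2+3A_1$, $2A_2$, $A_3$, $(A_3+A_1)\langle12\rangle$, $3A_2^{[3]}$, $A_3+2A_1$ (both classes), $A_3+3A_1$, $D_4(a_1)$, $D_4(a_1)+A_1$, $D_4$, $A_3+A_2$, $D_4(a_1)+2A_1$, $2A_3+A_1$, $A_4$, $A_5\langle6\rangle$, $D_4+3A_1$, $A_4+A_1$, $A_4+A_2$, $D_5(a_1)$, $(A_5+A_2)^{[3]}$, $A_5+A_1$ (the class contained in $W(E_7)$ as $A_5+A_1\subset A_7$), $D_5(a_1)+A_1$, $D_6(a_2)+A_1$, $E_6(a_2)$, $D_5$, $E_7(a_4)$, $D_5+A_1$, $A_6$, $D_6(a_1)$, $A_7$, $D_6+A_1$, $E_6(a_1)$, $E_6$, $E_7(a_3)$, $E_7(a_2)$, $E_7(a_1)$, $E_7$. * $E_8$: $A_1$, $2A_1$, $4A_1\langle24\rangle$, $A_2$, $8A_1$, $A_2+A_1$, $A_2+2A_1$, $A_3$, $A_2+4A_1$, $2A_2$, $3A_2^{[3]}$, $(A_3+2A_1)\langle12\rangle$,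 $D_4(a_1)$, $D_4$, $4A_2^{[3]}$, $A_3+4A_1$, $D_4(a_1)+A_1$, $A_3+A_2$, $2A_3\langle4\rangle$, $A_4$, $2A_3+2A_1$, $D_4(a_1)+A_2$, $D_4+4A_1$, $2D_4(a_1)$, $A_4+A_1$, $D_5(a_1)$, $D_4+A_2$, $A_4+2A_1$, $A_4+A_2$, $A_4+A_2+A_1$, $(A_5+A_1)\langle6\rangle$, $D_5(a_1)+A_1$, $D_4+A_3$, $E_6(a_2)$, $D_5$, $2A_4^{[5]}$, $D_5(a_1)+A_3$, $(A_5+A_2+A_1)^{[3]}$, $2D_4$, $(E_6(a_2)+A_2)^{[3]}$, $E_7(a_4)+A_1$, $D_5+2A_1$, $E_8(a_8)$, $D_6(a_1)$, $A_6$, $A_6+A_1$, $A_7\langle2\rangle$, $D_5+A_2$, $A_7+A_1$, $E_6(a_1)$, $D_6+2A_1$, $D_7(a_2)$, $E_6$, $A_7\langle0\rangle$, $D_8(a_3)$, $E_6(a_1)+A_1$, $A_8^{[3]}$, $E_7(a_3)$, $D_7(a_1)$, $D_8(a_2)$, $(E_6+A_2)^{[3]}$, $E_7(a_2)+A_1$,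 $E_8(a_6)$, $D_8(a_1)$, $E_8(a_7)$, $E_7(a_1)$, $E_8(a_3)$, $D_8$, $E_8(a_5)$, $E_7+A_1$, $E_8(a_4)$, $E_8(a_2)$, $E_8(a_1)$, $E_8$. **Proposition.** Let $\Delta_+$ be a system of positive roots associated to $s$, with $s$ as above, and let $(*)$ be any presentation of $s$. Let $m$ be an odd positive integer which is not divisible by $q$ if $q$ is defined. Then for any integers $p_1,\dots,p_l$ the system of equations $$Y_j\Bigl(\sum_{i=1}^{l'}m_i\gamma_i\Bigr)=m\,p_j,\qquad j=1,\dots,l,$$ in unknown integers $m_i\in\{-m+1,\dots,m-1\}$, $i=1,\dots,l'$, has no solution other than $m_1=\dots=m_{l'}=0$. -/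

import Mathlib

/-!
Throughout, `P` is a finite crystallographic root system over `ℝ`, with roots in the real vector
space `M` (the real form of the dual of the Cartan subalgebra).  `M` carries the canonical
Weyl-group-invariant inner product `P.RootForm`, by means of which `M` and its dual are identified;
so elements of the Cartan subalgebra are written as vectors `h` of `M`, and the value of the
root `α` on `h` is `P.RootForm h α`.
-/

open Module

namespace TransversalSlices

noncomputable section

/-! ### Weyl group elements and their presentation as a product of two involutions -/

/-- The Weyl group, as the group of linear automorphisms of `M` generated by the reflections. -/
def weylGroup {ι M N : Type*} [AddCommGroup M] [Module ℝ M] [AddCommGroup N] [Module ℝ N]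
    (P : RootPairing ι ℝ M N) : Subgroup (M ≃ₗ[ℝ] M) :=
  Subgroup.closure (Set.range P.reflection)

/-- The subspace of vectors fixed by `s`. -/
def fixedSpace {M : Type*} [AddCommGroup M] [Module ℝ M] (s : M ≃ₗ[ℝ] M) : Submodule ℝ M :=
  LinearMap.eqLocus (s : M →ₗ[ℝ] M) LinearMap.id

/-- The orthogonal complement of the subspace of vectors fixed by `s`. -/
def movedSpace {ι M N : Type*} [Fintype ι] [AddCommGroup M] [Module ℝ M] [AddCommGroup N]
    [Module ℝ N] (P : RootPairing ι ℝ M N) (s : M ≃ₗ[ℝ] M) : Submodule ℝ M where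
  carrier := {x | ∀ y ∈ fixedSpace s, P.RootForm y x = 0}
  zero_mem' := by simp
  add_mem' := by
    intro a b ha hb y hy
    rw [map_add, ha y hy, hb y hy, add_zero]
  smul_mem' := by
    intro c a ha y hy
    rw [map_smul, ha y hy, smul_zero]

/-- The product `s_{γ_i}`, `i < n`, of the first `n` of the reflections given by `γ`. -/
def firstFactor {ι M N : Type*} [AddCommGroup M] [Module ℝ M] [AddCommGroup N] [Module ℝ N]
    (P : RootPairing ι ℝ M N) {l' : ℕ} (n : ℕ) (γ : Fin l' → ι) : M ≃ₗ[ℝ] M :=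
  ((List.ofFn fun i => P.reflection (γ i)).take n).prod

/-- The product `s_{γ_i}`, `n ≤ i`, of the remaining reflections given by `γ`. -/
def secondFactor {ι M N : Type*} [AddCommGroup M] [Module ℝ M] [AddCommGroup N] [Module ℝ N]
    (P : RootPairing ι ℝ M N) {l' : ℕ} (n : ℕ) (γ : Fin l' → ι) : M ≃ₗ[ℝ] M :=
  ((List.ofFn fun i => P.reflection (γ i)).drop n).prod

/-- `s = s¹ s²` with `s¹ = s_{γ_1} ⋯ s_{γ_n}` and `s² = s_{γ_{n+1}} ⋯ s_{γ_{l'}}`, where the roots in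
each of the two sets `γ_1, …, γ_n` and `γ_{n+1}, …, γ_{l'}` are mutually orthogonal, and all the
`γ_i` together form a basis of the orthogonal complement of the fixed space of `s`.  (No choice of
signs is imposed: a root and its negative define the same reflection.) -/
structure IsInvolutionPresentation {ι M N : Type*} [Fintype ι] [AddCommGroup M] [Module ℝ M]
    [AddCommGroup N] [Module ℝ N] (P : RootPairing ι ℝ M N) (s : M ≃ₗ[ℝ] M) {l' : ℕ} (n : ℕ)
    (γ : Fin l' → ι) : Prop where
  le : n ≤ l'
  orthogonal : ∀ i j : Fin l', i ≠ j → (i.val < n ↔ j.val < n) → P.IsOrthogonal (γ i) (γ j)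
  linearIndependent : LinearIndependent ℝ fun i => P.root (γ i)
  span_eq : Submodule.span ℝ (Set.range fun i => P.root (γ i)) = movedSpace P s
  prod_eq : s = firstFactor P n γ * secondFactor P n γ

/-! ### Systems of positive roots associated to a Weyl group element -/

/-- For vectors `v_0, …, v_K`, the set of (indices of) roots `α` that are orthogonal to `v_j` for all
`j > i` and not orthogonal to `v_i`. -/
def layer {ι M N : Type*} [Fintype ι] [AddCommGroup M] [Module ℝ M] [AddCommGroup N] [Module ℝ N]
    (P : RootPairing ι ℝ M N) {K : ℕ} (v : Fin (K + 1) → M) (i : Fin (K + 1)) : Set ι :=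
  {α | (∀ j, i < j → P.RootForm (v j) (P.root α) = 0) ∧ P.RootForm (v i) (P.root α) ≠ 0}

open Classical in
/-- The sum of the `v_j` over `j ∈ J` with nonempty layer. -/
def layerSum {ι M N : Type*} [Fintype ι] [AddCommGroup M] [Module ℝ M] [AddCommGroup N]
    [Module ℝ N] (P : RootPairing ι ℝ M N) {K : ℕ} (v : Fin (K + 1) → M)
    (J : Finset (Fin (K + 1))) : M :=
  ∑ j ∈ J.filter (fun j => (layer P v j).Nonempty), v j

/-- An orthogonal decomposition `M = h_0 ⊕ h_1 ⊕ ⋯ ⊕ h_K` into subspaces invariant under the two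
involutions `s₁`, `s₂`, where `h_0` is the fixed space of `s = s₁ s₂` and each `h_i`, `i ≥ 1`, is
either a plane on which `s` is a rotation by an angle `θ_i` with `0 < θ_i < π`, or a line on which
`s` is multiplication by `-1` (then `θ_i = π`).  The summands are ordered so that the rotation
angle does not increase with `i`.  (If `a`, `b` are the lines of fixed points in `h_i` of the two
involutions and `λ` is the cosine of the angle between them, `0 ≤ λ < 1`, then `θ_i` is twice
that angle, so this is the ordering by increasing `λ`.) -/
structure IsOrderedSpectralDecomposition {ι M N : Type*} [Fintype ι] [AddCommGroup M] [Module ℝ M]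
    [AddCommGroup N] [Module ℝ N] (P : RootPairing ι ℝ M N) (s₁ s₂ : M ≃ₗ[ℝ] M) {K : ℕ}
    (h : Fin (K + 1) → Submodule ℝ M) (θ : Fin (K + 1) → ℝ) : Prop where
  iSup_eq_top : ⨆ i, h i = ⊤
  orthogonal : ∀ i j, i ≠ j → ∀ x ∈ h i, ∀ y ∈ h j, P.RootForm x y = 0
  invariant_first : ∀ i, ∀ x ∈ h i, s₁ x ∈ h i
  invariant_second : ∀ i, ∀ x ∈ h i, s₂ x ∈ h i
  zero_eq : h 0 = fixedSpace (s₁ * s₂)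
  plane_or_line : ∀ i, i ≠ 0 →
    (finrank ℝ (h i) = 2 ∧ 0 < θ i ∧ θ i < Real.pi ∧
      ∀ x ∈ h i, P.RootForm ((s₁ * s₂) x) x = Real.cos (θ i) * P.RootForm x x) ∨
    (finrank ℝ (h i) = 1 ∧ θ i = Real.pi ∧ ∀ x ∈ h i, (s₁ * s₂) x = -x)
  ordered : ∀ i j, i ≠ 0 → i < j → θ j ≤ θ i

/-- The positive system of the base `b` is associated to `s`: for some presentation `s = s¹ s²` and
some ordered decomposition `h_0, …, h_K` as above, there are `v_i ∈ h_i` such that `v_i` is not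
orthogonal to any root that is not orthogonal to `h_i`, such that on every root `α` of the layer
`i` the value of `v_i` dominates every sum of the values of `v_p, …, v_{i-1}` (only the indices
with nonempty layer being counted), and such that the positive roots are the roots on which
the sum of all the `v_i` with nonempty layer is positive. -/
def IsAssociatedBase {ι M N : Type*} [Fintype ι] [AddCommGroup M] [Module ℝ M]
    [AddCommGroup N] [Module ℝ N] (P : RootPairing ι ℝ M N) (s : M ≃ₗ[ℝ] M) (b : P.Base) : Prop :=
  ∃ (l' n : ℕ) (γ : Fin l' → ι) (K : ℕ) (h : Fin (K + 1) → Submodule ℝ M) (θ : Fin (K + 1) → ℝ)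
    (v : Fin (K + 1) → M),
    IsInvolutionPresentation P s n γ ∧
    IsOrderedSpectralDecomposition P (firstFactor P n γ) (secondFactor P n γ) h θ ∧
    (∀ i, v i ∈ h i) ∧
    (∀ i α, (∃ x ∈ h i, P.RootForm x (P.root α) ≠ 0) → P.RootForm (v i) (P.root α) ≠ 0) ∧
    (∀ i, ∀ α ∈ layer P v i, ∀ p < i,
      |P.RootForm (layerSum P v (Finset.Ico p i)) (P.root α)| <
        |P.RootForm (v i) (P.root α)|) ∧
    ∀ α, P.root α ∈ AddSubmonoid.closure (P.root '' b.support) ↔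
      0 < P.RootForm (layerSum P v Finset.univ) (P.root α)

/-! ### The functionals `Y_j` -/

/-- `d` is the family of coprime positive integers `d_i` for which the matrix `d_i a_{ij}` is
symmetric, where `a_{ij} = ⟨α_j, α_i^∨⟩`; the `(i, j)` entry of `b.cartanMatrix` is `⟨α_i, α_j^∨⟩`. -/
structure IsSymmetrizer {ι M N : Type*} [AddCommGroup M] [Module ℝ M] [AddCommGroup N]
    [Module ℝ N] {P : RootPairing ι ℝ M N} [P.IsCrystallographic] (b : P.Base)
    (d : b.support → ℕ) : Prop where
  pos : ∀ i, 0 < d i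
  gcd_eq_one : Finset.univ.gcd d = 1
  symm : ∀ i j, (d i : ℤ) * b.cartanMatrix j i = (d j : ℤ) * b.cartanMatrix i j

/-- The linear functional `Y_j` with `Y_j(α_i) = d_i δ_{ij}`, where the `α_i` are the simple roots. -/
def Y {ι M N : Type*} [AddCommGroup M] [Module ℝ M] [AddCommGroup N] [Module ℝ N]
    {P : RootPairing ι ℝ M N} [P.IsRootSystem] (b : P.Base) (d : b.support → ℕ)
    (j : b.support) : M →ₗ[ℝ] ℝ :=
  (d j : ℝ) • b.toWeightBasis.coord j

/-! ### The tables for the exceptional types -/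

/-- A line of a table: `s¹` and `s²` are given as the lists of the numbers of the roots whose
reflections they are products of; `q` is the entry in the column `q`, if there is one. -/
structure TableRow where
  first : List ℕ
  second : List ℕ
  q : Option ℕ

/-- The table of an exceptional type: the Cartan matrix for the chosen numbering of the simple
roots, the numbered list of positive roots (numbering starts from `1`), and the lines. -/
structure ExceptionalTable where
  rank : ℕ
  cartan : Matrix (Fin rank) (Fin rank) ℤ
  roots : List (List ℕ)
  rows : List TableRow

/-- The positive roots of type `G₂`, in coordinates with respect to the simple roots. -/
def rootsG₂ : List (List ℕ) := [
  [1,0], [0,1], [1,1], [2,1], [3,1], [3,2]]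

/-- The positive roots of type `F₄`, in coordinates with respect to the simple roots. -/
def rootsF₄ : List (List ℕ) := [
  [1,0,0,0], [0,1,0,0], [0,0,1,0], [0,0,0,1], [1,1,0,0], [0,1,1,0], [0,0,1,1], [1,1,1,0],
  [0,1,2,0], [0,1,1,1], [1,1,2,0], [1,1,1,1], [0,1,2,1], [1,2,2,0], [1,1,2,1], [0,1,2,2],
  [1,2,2,1], [1,1,2,2], [1,2,3,1], [1,2,2,2], [1,2,3,2], [1,2,4,2], [1,3,4,2], [2,3,4,2]]

/-- The positive roots of type `E₆`, in coordinates with respect to the simple roots. -/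
def rootsE₆ : List (List ℕ) := [
  [1,0,0,0,0,0], [0,1,0,0,0,0], [0,0,1,0,0,0], [0,0,0,1,0,0], [0,0,0,0,1,0], [0,0,0,0,0,1],
  [1,0,1,0,0,0], [0,1,0,1,0,0], [0,0,1,1,0,0], [0,0,0,1,1,0], [0,0,0,0,1,1], [1,0,1,1,0,0],
  [0,1,1,1,0,0], [0,1,0,1,1,0], [0,0,1,1,1,0], [0,0,0,1,1,1], [1,1,1,1,0,0], [1,0,1,1,1,0],
  [0,1,1,1,1,0], [0,1,0,1,1,1], [0,0,1,1,1,1], [1,1,1,1,1,0], [1,0,1,1,1,1], [0,1,1,2,1,0],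
  [0,1,1,1,1,1], [1,1,1,2,1,0], [1,1,1,1,1,1], [0,1,1,2,1,1], [1,1,2,2,1,0], [1,1,1,2,1,1],
  [0,1,1,2,2,1], [1,1,2,2,1,1], [1,1,1,2,2,1], [1,1,2,2,2,1], [1,1,2,3,2,1], [1,2,2,3,2,1]]

/-- The positive roots of type `E₇`, in coordinates with respect to the simple roots. -/
def rootsE₇ : List (List ℕ) := [
  [1,0,0,0,0,0,0], [0,1,0,0,0,0,0], [0,0,1,0,0,0,0], [0,0,0,1,0,0,0], [0,0,0,0,1,0,0],
  [0,0,0,0,0,1,0], [0,0,0,0,0,0,1], [1,0,1,0,0,0,0], [0,1,0,1,0,0,0], [0,0,1,1,0,0,0],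
  [0,0,0,1,1,0,0], [0,0,0,0,1,1,0], [0,0,0,0,0,1,1], [1,0,1,1,0,0,0], [0,1,1,1,0,0,0],
  [0,1,0,1,1,0,0], [0,0,1,1,1,0,0], [0,0,0,1,1,1,0], [0,0,0,0,1,1,1], [1,1,1,1,0,0,0],
  [1,0,1,1,1,0,0], [0,1,1,1,1,0,0], [0,1,0,1,1,1,0], [0,0,1,1,1,1,0], [0,0,0,1,1,1,1],
  [1,1,1,1,1,0,0], [1,0,1,1,1,1,0], [0,1,1,2,1,0,0], [0,1,1,1,1,1,0], [0,1,0,1,1,1,1],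
  [0,0,1,1,1,1,1], [1,1,1,2,1,0,0], [1,1,1,1,1,1,0], [1,0,1,1,1,1,1], [0,1,1,2,1,1,0],
  [0,1,1,1,1,1,1], [1,1,2,2,1,0,0], [1,1,1,2,1,1,0], [1,1,1,1,1,1,1], [0,1,1,2,2,1,0],
  [0,1,1,2,1,1,1], [1,1,2,2,1,1,0], [1,1,1,2,2,1,0], [1,1,1,2,1,1,1], [0,1,1,2,2,1,1],
  [1,1,2,2,2,1,0], [1,1,2,2,1,1,1], [1,1,1,2,2,1,1], [0,1,1,2,2,2,1], [1,1,2,3,2,1,0],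
  [1,1,2,2,2,1,1], [1,1,1,2,2,2,1], [1,2,2,3,2,1,0], [1,1,2,3,2,1,1], [1,1,2,2,2,2,1],
  [1,2,2,3,2,1,1], [1,1,2,3,2,2,1], [1,2,2,3,2,2,1], [1,1,2,3,3,2,1], [1,2,2,3,3,2,1],
  [1,2,2,4,3,2,1], [1,2,3,4,3,2,1], [2,2,3,4,3,2,1]]

/-- The positive roots of type `E₈`, in coordinates with respect to the simple roots. -/
def rootsE₈ : List (List ℕ) := [
  [1,0,0,0,0,0,0,0], [0,1,0,0,0,0,0,0], [0,0,1,0,0,0,0,0], [0,0,0,1,0,0,0,0],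
  [0,0,0,0,1,0,0,0], [0,0,0,0,0,1,0,0], [0,0,0,0,0,0,1,0], [0,0,0,0,0,0,0,1],
  [1,0,1,0,0,0,0,0], [0,1,0,1,0,0,0,0], [0,0,1,1,0,0,0,0], [0,0,0,1,1,0,0,0],
  [0,0,0,0,1,1,0,0], [0,0,0,0,0,1,1,0], [0,0,0,0,0,0,1,1], [1,0,1,1,0,0,0,0],
  [0,1,1,1,0,0,0,0], [0,1,0,1,1,0,0,0], [0,0,1,1,1,0,0,0], [0,0,0,1,1,1,0,0],
  [0,0,0,0,1,1,1,0], [0,0,0,0,0,1,1,1], [1,1,1,1,0,0,0,0], [1,0,1,1,1,0,0,0],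
  [0,1,1,1,1,0,0,0], [0,1,0,1,1,1,0,0], [0,0,1,1,1,1,0,0], [0,0,0,1,1,1,1,0],
  [0,0,0,0,1,1,1,1], [1,1,1,1,1,0,0,0], [1,0,1,1,1,1,0,0], [0,1,1,2,1,0,0,0],
  [0,1,1,1,1,1,0,0], [0,1,0,1,1,1,1,0], [0,0,1,1,1,1,1,0], [0,0,0,1,1,1,1,1],
  [1,1,1,2,1,0,0,0], [1,1,1,1,1,1,0,0], [1,0,1,1,1,1,1,0], [0,1,1,2,1,1,0,0],
  [0,1,1,1,1,1,1,0], [0,1,0,1,1,1,1,1], [0,0,1,1,1,1,1,1], [1,1,2,2,1,0,0,0],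
  [1,1,1,2,1,1,0,0], [1,1,1,1,1,1,1,0], [1,0,1,1,1,1,1,1], [0,1,1,2,2,1,0,0],
  [0,1,1,2,1,1,1,0], [0,1,1,1,1,1,1,1], [1,1,2,2,1,1,0,0], [1,1,1,2,2,1,0,0],
  [1,1,1,2,1,1,1,0], [1,1,1,1,1,1,1,1], [0,1,1,2,2,1,1,0], [0,1,1,2,1,1,1,1],
  [1,1,2,2,2,1,0,0], [1,1,2,2,1,1,1,0], [1,1,1,2,2,1,1,0], [1,1,1,2,1,1,1,1],
  [0,1,1,2,2,2,1,0], [0,1,1,2,2,1,1,1], [1,1,2,3,2,1,0,0], [1,1,2,2,2,1,1,0],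
  [1,1,2,2,1,1,1,1], [1,1,1,2,2,2,1,0], [1,1,1,2,2,1,1,1], [0,1,1,2,2,2,1,1],
  [1,2,2,3,2,1,0,0], [1,1,2,3,2,1,1,0], [1,1,2,2,2,2,1,0], [1,1,2,2,2,1,1,1],
  [1,1,1,2,2,2,1,1], [0,1,1,2,2,2,2,1], [1,2,2,3,2,1,1,0], [1,1,2,3,2,2,1,0],
  [1,1,2,3,2,1,1,1], [1,1,2,2,2,2,1,1], [1,1,1,2,2,2,2,1], [1,2,2,3,2,2,1,0],
  [1,2,2,3,2,1,1,1], [1,1,2,3,3,2,1,0], [1,1,2,3,2,2,1,1], [1,1,2,2,2,2,2,1],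
  [1,2,2,3,3,2,1,0], [1,2,2,3,2,2,1,1], [1,1,2,3,3,2,1,1], [1,1,2,3,2,2,2,1],
  [1,2,2,4,3,2,1,0], [1,2,2,3,3,2,1,1], [1,2,2,3,2,2,2,1], [1,1,2,3,3,2,2,1],
  [1,2,3,4,3,2,1,0], [1,2,2,4,3,2,1,1], [1,2,2,3,3,2,2,1], [1,1,2,3,3,3,2,1],
  [2,2,3,4,3,2,1,0], [1,2,3,4,3,2,1,1], [1,2,2,4,3,2,2,1], [1,2,2,3,3,3,2,1],
  [2,2,3,4,3,2,1,1], [1,2,3,4,3,2,2,1], [1,2,2,4,3,3,2,1], [2,2,3,4,3,2,2,1],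
  [1,2,3,4,3,3,2,1], [1,2,2,4,4,3,2,1], [2,2,3,4,3,3,2,1], [1,2,3,4,4,3,2,1],
  [2,2,3,4,4,3,2,1], [1,2,3,5,4,3,2,1], [2,2,3,5,4,3,2,1], [1,3,3,5,4,3,2,1],
  [2,3,3,5,4,3,2,1], [2,2,4,5,4,3,2,1], [2,3,4,5,4,3,2,1], [2,3,4,6,4,3,2,1],
  [2,3,4,6,5,3,2,1], [2,3,4,6,5,4,2,1], [2,3,4,6,5,4,3,1], [2,3,4,6,5,4,3,2]]

/-- The table of type `G₂`; each line is labelled by the class of the Weyl group in Carter's notation. -/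
def rowsG₂ : List TableRow := [
  ⟨[6], [], some 3⟩, -- A_1
  ⟨[4], [], none⟩, -- Ã_1
  ⟨[6], [1], some 3⟩, -- A_1+Ã_1
  ⟨[5], [2], some 3⟩, -- A_2
  ⟨[1], [2], some 3⟩ ] -- G_2

/-- The table of type `F₄`; each line is labelled by the class of the Weyl group in Carter's notation. -/
def rowsF₄ : List TableRow := [
  ⟨[24], [], none⟩, -- A_1
  ⟨[21], [], none⟩, -- Ã_1
  ⟨[24], [16], none⟩, -- 2A_1
  ⟨[16, 24], [2, 9], none⟩, -- 4A_1
  ⟨[23], [1], none⟩, -- A_2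
  ⟨[19], [4], none⟩, -- Ã_2
  ⟨[16], [8], none⟩, -- B_2
  ⟨[23, 7], [1], none⟩, -- A_2+Ã_1
  ⟨[19, 5], [4], none⟩, -- Ã_2+A_1
  ⟨[23, 3], [1, 4], some 3⟩, -- A_2+Ã_2
  ⟨[1, 14], [16], none⟩, -- A_3
  ⟨[16], [8, 9], none⟩, -- B_2+A_1
  ⟨[1, 14], [3, 16], none⟩, -- A_3+Ã_1
  ⟨[16, 2], [5, 11], none⟩, -- D_4(a_1)
  ⟨[16, 9, 2], [1], none⟩, -- D_4
  ⟨[3, 14], [4, 1], none⟩, -- C_3+A_1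
  ⟨[1, 3], [9, 10], none⟩, -- F_4(a_1)
  ⟨[9, 2], [1, 4], none⟩, -- B_4
  ⟨[1, 3], [2, 4], none⟩ ] -- F_4

/-- The table of type `E₆`; each line is labelled by the class of the Weyl group in Carter's notation. -/
def rowsE₆ : List TableRow := [
  ⟨[36], [], none⟩, -- A_1
  ⟨[36], [23], none⟩, -- 2A_1
  ⟨[36, 23], [4, 15], none⟩, -- 4A_1
  ⟨[35], [2], none⟩, -- A_2
  ⟨[35, 11], [2], none⟩, -- A_2+A_1
  ⟨[35, 6], [2, 5], none⟩, -- 2A_2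
  ⟨[35, 11], [2, 7], none⟩, -- A_2+2A_1
  ⟨[24, 2], [23], none⟩, -- A_3
  ⟨[35, 1, 5], [2, 3, 6], some 3⟩, -- 3A_2
  ⟨[2, 5, 24], [23, 3], none⟩, -- A_3+2A_1
  ⟨[23, 4], [8, 19], none⟩, -- D_4(a_1)
  ⟨[24, 21], [2, 1], none⟩, -- A_4
  ⟨[23, 4, 15], [2], none⟩, -- D_4
  ⟨[24, 21, 5], [2, 1], none⟩, -- A_4+A_1
  ⟨[14, 13, 15], [1, 6, 4], none⟩, -- A_5+A_1
  ⟨[2, 7], [15, 12, 16], none⟩, -- D_5(a_1)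
  ⟨[1, 2, 6], [9, 10, 19], none⟩, -- E_6(a_2)
  ⟨[6, 1, 2], [4, 15], none⟩, -- D_5
  ⟨[6, 8, 9], [1, 2, 5], none⟩, -- E_6(a_1)
  ⟨[1, 4, 6], [2, 3, 5], none⟩ ] -- E_6

/-- The table of type `E₇`; each line is labelled by the class of the Weyl group in Carter's notation
(both classes of type `4A_1` and both classes of type `A_3+2A_1` are listed). -/
def rowsE₇ : List TableRow := [
  ⟨[63], [], none⟩, -- A_1
  ⟨[63], [49], none⟩, -- 2A_1
  ⟨[63], [7, 49], none⟩, -- (3A_1)'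
  ⟨[2, 3], [5, 28], none⟩, -- 4A_1, contained in D_4
  ⟨[63, 49], [2, 28], none⟩, -- 4A_1, not contained in D_4
  ⟨[62], [1], none⟩, -- A_2
  ⟨[41, 63, 40, 19], [2, 3, 6], none⟩, -- 7A_1
  ⟨[30, 62], [1], none⟩, -- A_2+A_1
  ⟨[30, 62], [1, 18], none⟩, -- A_2+2A_1
  ⟨[30, 62], [1, 5, 18], none⟩, -- A_2+3A_1
  ⟨[23, 62], [1, 7], none⟩, -- 2A_2
  ⟨[1, 37], [49], none⟩, -- A_3
  ⟨[1, 37], [7, 49], none⟩, -- (A_3+A_1)'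
  ⟨[5, 25, 62], [1, 2, 6], some 3⟩, -- 3A_2
  ⟨[1, 2, 5], [4, 37], none⟩, -- A_3+2A_1, contained in D_5
  ⟨[1, 16, 37], [7, 49], none⟩, -- A_3+2A_1, not contained in D_5
  ⟨[14, 26, 28], [3, 7, 49], none⟩, -- A_3+3A_1
  ⟨[3, 49], [8, 32], none⟩, -- D_4(a_1)
  ⟨[3, 7, 49], [8, 32], none⟩, -- D_4(a_1)+A_1
  ⟨[3, 28, 49], [1], none⟩, -- D_4
  ⟨[20, 21, 22], [4, 49], none⟩, -- A_3+A_2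
  ⟨[3, 7, 49], [8, 2, 32], none⟩, -- D_4(a_1)+2A_1
  ⟨[4, 7, 16, 49], [3, 20, 21], none⟩, -- 2A_3+A_1
  ⟨[37, 45], [1, 6], none⟩, -- A_4
  ⟨[1, 7, 37], [23, 24], none⟩, -- A_5'
  ⟨[28, 49, 3], [1, 7, 2, 5], none⟩, -- D_4+3A_1
  ⟨[9, 37, 45], [1, 6], none⟩, -- A_4+A_1
  ⟨[4, 37, 45], [1, 2, 6], none⟩, -- A_4+A_2
  ⟨[3, 28, 49], [1, 30], none⟩, -- D_5(a_1)
  ⟨[1, 5, 7, 37], [4, 23, 24], some 3⟩, -- A_5+A_2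
  ⟨[4, 16, 37], [1, 12, 13], none⟩, -- (A_5+A_1)''
  ⟨[3, 28, 49], [1, 5, 30], none⟩, -- D_5(a_1)+A_1
  ⟨[2, 7, 8, 32], [5, 23, 24], none⟩, -- D_6(a_2)+A_1
  ⟨[1, 4, 16], [28, 29, 31], none⟩, -- E_6(a_2)
  ⟨[3, 28], [1, 6, 19], none⟩, -- D_5
  ⟨[1, 2, 12, 13], [15, 17, 32], none⟩, -- E_7(a_4)
  ⟨[2, 3, 28], [1, 6, 19], none⟩, -- D_5+A_1
  ⟨[11, 19, 26], [6, 9, 10], none⟩, -- A_6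
  ⟨[3, 5, 28], [1, 12, 13], none⟩, -- D_6(a_1)
  ⟨[4, 16, 15, 17], [1, 12, 13], none⟩, -- A_7
  ⟨[1, 6, 9], [7, 10, 11, 22], none⟩, -- D_6+A_1
  ⟨[8, 19, 22], [1, 4, 6], none⟩, -- E_6(a_1)
  ⟨[3, 6, 19], [1, 9, 11], none⟩, -- E_6
  ⟨[7, 10, 11, 22], [1, 2, 6], none⟩, -- E_7(a_3)
  ⟨[2, 3, 12, 13], [1, 9, 11], none⟩, -- E_7(a_2)
  ⟨[6, 9, 10], [1, 2, 5, 7], none⟩, -- E_7(a_1)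
  ⟨[1, 4, 6], [2, 3, 5, 7], none⟩ ] -- E_7

/-- The table of type `E₈`; each line is labelled by the class of the Weyl group in Carter's notation. -/
def rowsE₈ : List TableRow := [
  ⟨[120], [], none⟩, -- A_1
  ⟨[120], [97], none⟩, -- 2A_1
  ⟨[97, 120], [7, 61], none⟩, -- (4A_1)'
  ⟨[119], [8], none⟩, -- A_2
  ⟨[74, 118, 104, 32], [2, 3, 5, 8], none⟩, -- 8A_1
  ⟨[69, 119], [8], none⟩, -- A_2+A_1
  ⟨[69, 119], [8, 31], none⟩, -- A_2+2A_1
  ⟨[8, 74], [97], none⟩, -- A_3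
  ⟨[31, 69, 119], [4, 8, 19], none⟩, -- A_2+4A_1
  ⟨[63, 119], [2, 8], none⟩, -- 2A_2
  ⟨[6, 63, 119], [2, 5, 8], some 3⟩, -- 3A_2
  ⟨[8, 48, 74], [6, 97], none⟩, -- (A_3+2A_1)'
  ⟨[7, 97], [15, 68], none⟩, -- D_4(a_1)
  ⟨[7, 61, 97], [8], none⟩, -- D_4
  ⟨[3, 5, 63, 119], [1, 2, 6, 8], some 3⟩, -- 4A_2
  ⟨[8, 74, 48, 17], [4, 6, 97], none⟩, -- A_3+4A_1
  ⟨[7, 32, 97], [15, 68], none⟩, -- D_4(a_1)+A_1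
  ⟨[29, 55, 56], [6, 97], none⟩, -- A_3+A_2
  ⟨[13, 22, 40, 62], [7, 97], none⟩, -- (2A_3)'
  ⟨[74, 93], [1, 8], none⟩, -- A_4
  ⟨[62, 22, 13, 40], [97, 7, 3, 2], none⟩, -- 2A_3+2A_1
  ⟨[7, 25, 97], [4, 15, 68], none⟩, -- D_4(a_1)+A_2
  ⟨[97, 61, 7, 32], [8, 5, 2, 3], none⟩, -- D_4+4A_1
  ⟨[2, 3, 7, 97], [11, 12, 15, 68], none⟩, -- 2D_4(a_1)
  ⟨[26, 74, 93], [1, 8], none⟩, -- A_4+A_1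
  ⟨[8, 31], [39, 61, 75], none⟩, -- D_5(a_1)
  ⟨[49, 59, 63, 71], [2, 8], none⟩, -- D_4+A_2
  ⟨[26, 74, 93], [1, 8, 12], none⟩, -- A_4+2A_1
  ⟨[18, 74, 93], [1, 6, 8], none⟩, -- A_4+A_2
  ⟨[18, 74, 93], [1, 4, 6, 8], none⟩, -- A_4+A_2+A_1
  ⟨[22, 61, 62], [7, 23, 24], none⟩, -- (A_5+A_1)'
  ⟨[8, 19, 31], [39, 61, 75], none⟩, -- D_5(a_1)+A_1
  ⟨[31, 46, 61, 70], [8, 10, 25], none⟩, -- D_4+A_3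
  ⟨[1, 8, 44], [34, 35, 68], none⟩, -- E_6(a_2)
  ⟨[1, 8, 44], [7, 61], none⟩, -- D_5
  ⟨[4, 6, 74, 93], [1, 2, 5, 8], some 5⟩, -- 2A_4
  ⟨[4, 8, 17, 18], [53, 64, 61, 31], none⟩, -- D_5(a_1)+A_3
  ⟨[3, 22, 61, 62], [4, 7, 23, 24], some 3⟩, -- A_5+A_2+A_1
  ⟨[8, 4, 19, 31], [59, 58, 61, 2], none⟩, -- 2D_4
  ⟨[1, 4, 8, 44], [5, 34, 35, 68], some 3⟩, -- E_6(a_2)+A_2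
  ⟨[8, 37, 9, 5], [59, 61, 58, 2], none⟩, -- E_7(a_4)+A_1
  ⟨[8, 1, 44, 18], [4, 7, 61], none⟩, -- D_5+2A_1
  ⟨[2, 3, 6, 8], [19, 41, 59, 76], none⟩, -- E_8(a_8)
  ⟨[3, 7, 61], [8, 9, 37], none⟩, -- D_6(a_1)
  ⟨[40, 44, 62], [1, 13, 14], none⟩, -- A_6
  ⟨[2, 40, 44, 62], [1, 13, 14], none⟩, -- A_6+A_1
  ⟨[26, 28, 41, 27], [8, 9, 37], none⟩, -- A_7'
  ⟨[8, 23, 24, 25], [4, 7, 61], none⟩, -- D_5+A_2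
  ⟨[26, 28, 41, 27], [5, 8, 9, 37], none⟩, -- A_7+A_1
  ⟨[15, 44, 55], [1, 6, 8], none⟩, -- E_6(a_1)
  ⟨[3, 49, 21, 48], [1, 2, 6, 8], none⟩, -- D_6+2A_1
  ⟨[4, 7, 61], [3, 8, 16, 30], none⟩, -- D_7(a_2)
  ⟨[1, 7, 44], [8, 26, 27], none⟩, -- E_6
  ⟨[21, 22, 26, 27], [16, 30, 32], none⟩, -- A_7''
  ⟨[3, 5, 7, 61], [4, 8, 23, 24], none⟩, -- D_8(a_3)
  ⟨[15, 44, 55], [1, 6, 8, 10], none⟩, -- E_6(a_1)+A_1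
  ⟨[22, 23, 26, 31], [7, 11, 12, 25], some 3⟩, -- A_8
  ⟨[27, 28, 32, 41], [1, 2, 8], none⟩, -- E_7(a_3)
  ⟨[48, 3, 49, 21], [1, 8, 26], none⟩, -- D_7(a_1)
  ⟨[1, 6, 8], [12, 21, 25, 27, 49], none⟩, -- D_8(a_2)
  ⟨[1, 5, 7, 44], [4, 8, 26, 27], some 3⟩, -- E_6+A_2
  ⟨[7, 18, 23, 24], [4, 8, 26, 27], none⟩, -- E_7(a_2)+A_1
  ⟨[1, 2, 5, 8], [21, 25, 27, 49], none⟩, -- E_8(a_6)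
  ⟨[7, 17, 18, 19], [1, 20, 21, 22], none⟩, -- D_8(a_1)
  ⟨[4, 7, 23, 24], [5, 8, 20, 33], none⟩, -- E_8(a_7)
  ⟨[1, 13, 14], [3, 5, 8, 32], none⟩, -- E_7(a_1)
  ⟨[3, 7, 23, 24], [4, 8, 26, 27], none⟩, -- E_8(a_3)
  ⟨[4, 8, 17, 26, 27], [1, 5, 7], none⟩, -- D_8
  ⟨[10, 16, 20, 22], [2, 3, 5, 7], none⟩, -- E_8(a_5)
  ⟨[1, 6, 8, 10], [7, 11, 12, 25], none⟩, -- E_7+A_1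
  ⟨[7, 11, 12, 25], [1, 2, 6, 8], none⟩, -- E_8(a_4)
  ⟨[2, 3, 5, 7], [1, 8, 10, 20], none⟩, -- E_8(a_2)
  ⟨[6, 8, 10, 11], [1, 2, 5, 7], none⟩, -- E_8(a_1)
  ⟨[1, 4, 6, 8], [2, 3, 5, 7], none⟩ ] -- E_8

/-- Type `G₂`; here the simple root number `1` is the short one. -/
def tableG₂ : ExceptionalTable := ⟨2, CartanMatrix.G₂.transpose, rootsG₂, rowsG₂⟩

/-- Type `F₄`. -/
def tableF₄ : ExceptionalTable := ⟨4, CartanMatrix.F₄, rootsF₄, rowsF₄⟩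

/-- Type `E₆`. -/
def tableE₆ : ExceptionalTable := ⟨6, CartanMatrix.E₆, rootsE₆, rowsE₆⟩

/-- Type `E₇`. -/
def tableE₇ : ExceptionalTable := ⟨7, CartanMatrix.E₇, rootsE₇, rowsE₇⟩

/-- Type `E₈`. -/
def tableE₈ : ExceptionalTable := ⟨8, CartanMatrix.E₈, rootsE₈, rowsE₈⟩

/-- The tables of all exceptional types. -/
def exceptionalTables : List ExceptionalTable := [tableG₂, tableF₄, tableE₆, tableE₇, tableE₈]

/-- The coefficient of the `j`-th simple root in the root number `k` (numbered from `1`). -/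
def ExceptionalTable.coeff (T : ExceptionalTable) (k : ℕ) (j : Fin T.rank) : ℕ :=
  (T.roots.getD (k - 1) []).getD j 0

/-! ### The number `q` -/

/-- The numbering `e` of the simple roots of the base `b` turns the Cartan matrix into `A`. -/
def HasCartanMatrix {ι M N : Type*} [AddCommGroup M] [Module ℝ M] [AddCommGroup N] [Module ℝ N]
    {P : RootPairing ι ℝ M N} [P.IsCrystallographic] (b : P.Base) {n : ℕ} (e : Fin n ≃ b.support)
    (A : Matrix (Fin n) (Fin n) ℤ) : Prop :=
  ∀ i j, b.cartanMatrix (e i) (e j) = A i j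

/-- `P` is of one of the classical types `A_n` (`n ≥ 1`), `B_n`, `C_n` (`n ≥ 2`), `D_n` (`n ≥ 4`). -/
def IsClassical {ι M N : Type*} [AddCommGroup M] [Module ℝ M] [AddCommGroup N] [Module ℝ N]
    (P : RootPairing ι ℝ M N) [P.IsCrystallographic] : Prop :=
  ∃ (b : P.Base) (n : ℕ) (e : Fin n ≃ b.support),
    (1 ≤ n ∧ HasCartanMatrix b e (CartanMatrix.A n)) ∨
    (2 ≤ n ∧ HasCartanMatrix b e (CartanMatrix.B n)) ∨
    (2 ≤ n ∧ HasCartanMatrix b e (CartanMatrix.C n)) ∨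
    (4 ≤ n ∧ HasCartanMatrix b e (CartanMatrix.D n))

/-- `P` is of the exceptional type of the table `T`, and `s` lies in the conjugacy class of the Weyl
group described by the line `r`: it is conjugate to the product of the reflections in the roots
with the numbers listed in `r`. -/
def InClassOfRow {ι M N : Type*} [AddCommGroup M] [Module ℝ M] [AddCommGroup N] [Module ℝ N]
    (P : RootPairing ι ℝ M N) [P.IsCrystallographic] (T : ExceptionalTable) (r : TableRow)
    (s : M ≃ₗ[ℝ] M) : Prop :=
  ∃ (b : P.Base) (e : Fin T.rank ≃ b.support), HasCartanMatrix b e T.cartan ∧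
    ∃ β : List ι,
      List.Forall₂ (fun k i => P.root i = ∑ j, T.coeff k j • P.root (e j))
        (r.first ++ r.second) β ∧
      ∃ w ∈ weylGroup P, s = w * (β.map P.reflection).prod * w⁻¹

/-- `TableEntry P s q`: the number attached to `s` is `q`, where `none` means that it is not defined.
It is not defined for the classical types.  For the exceptional types, `s` is in one of the classes
listed in the table of that type, and the number is the entry of the table; the class of the
identity, which the tables do not list, has no number. -/
inductive TableEntry {ι M N : Type*} [AddCommGroup M] [Module ℝ M] [AddCommGroup N] [Module ℝ N]
    (P : RootPairing ι ℝ M N) [P.IsCrystallographic] : (M ≃ₗ[ℝ] M) → Option ℕ → Prop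
  | classical (s : M ≃ₗ[ℝ] M) : IsClassical P → TableEntry P s none
  | identity : TableEntry P 1 none
  | exceptional (T : ExceptionalTable) (r : TableRow) (s : M ≃ₗ[ℝ] M) :
      T ∈ exceptionalTables → r ∈ T.rows → InClassOfRow P T r s → TableEntry P s r.q

end

end TransversalSlices

/-!
Let `c` be the unit in which the squared lengths of the simple roots are the numbers `d_j`, and let
`r_γ` be the squared length of a root `γ` in this unit.  Then `Y_j(γ)` is the coefficient of
`α_j^∨` in `r_γ γ^∨`, so the equations say that `∑ m_i r_{γ_i} γ_i^∨` is divisible by `m` in the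
coroot lattice.  Hence all `m_i` are divisible by `m`, and being smaller than `m` they vanish, as
soon as the `r_{γ_i}` are prime to `m` and the coroots `γ_i^∨` are linearly independent modulo `m`
(`eq_zero_of_isIndependentMod`).  Neither condition involves the positive system: this is true for
every base.

*Classical types.*  The coroots have coordinates in which each of them is one of `±e_a ± e_b`, `±e_a`,
`±2e_a`.  For such vectors linear independence over `ℝ` implies linear independence modulo every
odd `m`: a vector of this form is eliminated by forgetting a coordinate, or by identifying two
coordinates up to sign, and this leaves the form of the other vectors unchanged
(`dvd_of_sum_smul_eq_of_isShortSum`, `isIndependentMod_of_isShortSum`).  The numbers `r_γ` are `1` or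
`2`.

*Exceptional types.*  A line of a table gives one presentation `β_1, …, β_k` of an element of the
class.  Integral elimination produces integral coweights `f_a` and integral weights `x_a` that are
dual to the `β_t` and to the `β_t^∨` up to factors dividing powers of `2q`, so prime to `m`
(`exists_dualSystem`).  To pass to an arbitrary presentation `γ_1, …, γ_l` one uses the identity
`(1 - s) x = ∑ ⟨x, γ_t^∨⟩ v_t`, where the `v_t` are roots that arise from the `γ_t` by an integral
unitriangular transformation (`exists_sub_reflectionProd_eq_sum`), and the same identity for `β`.
The matrix `⟨(1 - s) x_b, f_a⟩` has, by the identity for `β`, a determinant prime to `m`; by the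
identity for `γ`, this determinant is a multiple of that of `⟨x_b, γ_t^∨⟩`, which is therefore prime
to `m` too (`DualSystem.isIndependentMod`).  The numbers `k` and `l` agree, since both families are
bases of the orthogonal complement of the fixed space of `s` (`DualSystem.card_eq`).  The
numbers `r_γ` are `1`, `2`, or, in type `G₂`, `3`; in the last case `3 ∤ m` unless there is only one
root `γ`, and this root is short.
-/

namespace TransversalSlices

/-! ### Integral relations between vectors `±e_a ± e_b`, `±e_a`, `±2e_a` -/

/-- The real number `ε` is one of `-1`, `0`, `1`. -/
def IsSign (ε : ℝ) : Prop := ε = -1 ∨ ε = 0 ∨ ε = 1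

/-- The vector has at most two terms `±e_a` in the coordinate basis: it is one of `0`, `±e_a`,
`±2e_a`, `±e_a ± e_b`.  In suitable coordinates all coroots of the classical root systems are
of this form. -/
def IsShortSum {κ : Type*} [DecidableEq κ] (v : κ → ℝ) : Prop :=
  ∃ a b : κ, ∃ s t : ℝ, IsSign s ∧ IsSign t ∧ v = Pi.single a s + Pi.single b t

/-- The linear map takes each coordinate vector to `0` or to a coordinate vector up to sign. -/
def IsSignedMap {κ : Type*} [DecidableEq κ] (T : (κ → ℝ) →ₗ[ℝ] (κ → ℝ)) : Prop :=
  ∀ a, ∃ b, ∃ ε : ℝ, IsSign ε ∧ T (Pi.single a 1) = Pi.single b ε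

/-- All coordinates of the vector are integers. -/
def IsIntegral {κ : Type*} (w : κ → ℝ) : Prop := ∀ a, ∃ z : ℤ, w a = z

lemma IsSign.mul {s t : ℝ} (hs : IsSign s) (ht : IsSign t) : IsSign (s * t) := by
  rcases hs with rfl | rfl | rfl <;> rcases ht with rfl | rfl | rfl <;> norm_num [IsSign]

lemma IsSign.neg {s : ℝ} (hs : IsSign s) : IsSign (-s) := by
  rcases hs with rfl | rfl | rfl <;> norm_num [IsSign]

lemma IsSign.exists_int {s : ℝ} (hs : IsSign s) : ∃ z : ℤ, s = z := by
  rcases hs with rfl | rfl | rfl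
  exacts [⟨-1, by simp⟩, ⟨0, by simp⟩, ⟨1, by simp⟩]

lemma IsIntegral.sub {κ : Type*} {v w : κ → ℝ} (hv : IsIntegral v) (hw : IsIntegral w) :
    IsIntegral (v - w) := fun a => by
  obtain ⟨y, hy⟩ := hv a
  obtain ⟨z, hz⟩ := hw a
  exact ⟨y - z, by simp [hy, hz]⟩

lemma IsIntegral.add {κ : Type*} {v w : κ → ℝ} (hv : IsIntegral v) (hw : IsIntegral w) :
    IsIntegral (v + w) := fun a => by
  obtain ⟨y, hy⟩ := hv a
  obtain ⟨z, hz⟩ := hw a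
  exact ⟨y + z, by simp [hy, hz]⟩

lemma IsIntegral.int_smul {κ : Type*} {v : κ → ℝ} (hv : IsIntegral v) (x : ℤ) :
    IsIntegral ((x : ℝ) • v) := fun a => by
  obtain ⟨y, hy⟩ := hv a
  exact ⟨x * y, by simp [hy]⟩

lemma IsIntegral.sum {κ τ : Type*} (S : Finset τ) {v : τ → κ → ℝ} (hv : ∀ i, IsIntegral (v i)) :
    IsIntegral (∑ i ∈ S, v i) := by
  induction S using Finset.cons_induction with
  | empty => exact fun a => ⟨0, by simp⟩
  | cons i S hi ih => rw [Finset.sum_cons]; exact (hv i).add ih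

lemma isIntegral_single {κ : Type*} [DecidableEq κ] (a : κ) {s : ℝ} (hs : IsSign s) :
    IsIntegral (Pi.single a s : κ → ℝ) := fun c => by
  rcases eq_or_ne c a with rfl | h
  · simpa using hs.exists_int
  · exact ⟨0, by simp [h]⟩

lemma IsShortSum.isIntegral {κ : Type*} [DecidableEq κ] {v : κ → ℝ} (hv : IsShortSum v) :
    IsIntegral v := by
  obtain ⟨a, b, s, t, hs, ht, rfl⟩ := hv
  exact (isIntegral_single a hs).add (isIntegral_single b ht)

lemma IsShortSum.neg {κ : Type*} [DecidableEq κ] {v : κ → ℝ} (hv : IsShortSum v) :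
    IsShortSum (-v) := by
  obtain ⟨a, b, s, t, hs, ht, rfl⟩ := hv
  exact ⟨a, b, -s, -t, hs.neg, ht.neg, by rw [neg_add, Pi.single_neg, Pi.single_neg]⟩

lemma single_eq_smul {κ : Type*} [DecidableEq κ] (a : κ) (s : ℝ) :
    (Pi.single a s : κ → ℝ) = s • Pi.single a 1 := by
  rw [← Pi.single_smul, smul_eq_mul, mul_one]

lemma IsSignedMap.single {κ : Type*} [DecidableEq κ] {T : (κ → ℝ) →ₗ[ℝ] (κ → ℝ)}
    (hT : IsSignedMap T) (a : κ) {s : ℝ} (hs : IsSign s) :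
    ∃ b, ∃ ε : ℝ, IsSign ε ∧ T (Pi.single a s) = Pi.single b ε := by
  obtain ⟨b, ε, hε, h⟩ := hT a
  refine ⟨b, s * ε, hs.mul hε, ?_⟩
  rw [single_eq_smul, map_smul, h, ← Pi.single_smul, smul_eq_mul]

lemma IsSignedMap.isShortSum {κ : Type*} [DecidableEq κ] {T : (κ → ℝ) →ₗ[ℝ] (κ → ℝ)}
    (hT : IsSignedMap T) {v : κ → ℝ} (hv : IsShortSum v) : IsShortSum (T v) := by
  obtain ⟨a, b, s, t, hs, ht, rfl⟩ := hv
  obtain ⟨a', s', hs', ha⟩ := hT.single a hs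
  obtain ⟨b', t', ht', hb⟩ := hT.single b ht
  exact ⟨a', b', s', t', hs', ht', by rw [map_add, ha, hb]⟩

lemma eq_sum_smul_single {κ : Type*} [Fintype κ] [DecidableEq κ] (w : κ → ℝ) :
    w = ∑ a, w a • (Pi.single a 1 : κ → ℝ) := by
  ext c
  simp [Finset.sum_apply, Pi.single_apply]

lemma IsSignedMap.isIntegral {κ : Type*} [Fintype κ] [DecidableEq κ]
    {T : (κ → ℝ) →ₗ[ℝ] (κ → ℝ)} (hT : IsSignedMap T) {w : κ → ℝ} (hw : IsIntegral w) :
    IsIntegral (T w) := by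
  rw [eq_sum_smul_single w, map_sum]
  refine IsIntegral.sum _ fun a => ?_
  obtain ⟨b, ε, hε, h⟩ := hT a
  obtain ⟨z, hz⟩ := hw a
  rw [map_smul, h, hz]
  exact (isIntegral_single b hε).int_smul z

/-- A nonzero vector `±e_a ± e_b`, `±e_a` or `±2e_a` spans the kernel of a map which takes
coordinate vectors to `0` or to coordinate vectors up to sign. -/
lemma IsShortSum.exists_elimination {κ : Type*} [Fintype κ] [DecidableEq κ] {v : κ → ℝ}
    (hv : IsShortSum v) (h0 : v ≠ 0) :
    ∃ T : (κ → ℝ) →ₗ[ℝ] (κ → ℝ), IsSignedMap T ∧ T v = 0 ∧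
      LinearMap.ker T ≤ Submodule.span ℝ {v} := by
  -- a multiple of a coordinate vector: forget this coordinate
  have key : ∀ (a : κ) (u : ℝ), u ≠ 0 → ∃ T : (κ → ℝ) →ₗ[ℝ] (κ → ℝ), IsSignedMap T ∧
      T (Pi.single a u) = 0 ∧ LinearMap.ker T ≤ Submodule.span ℝ {(Pi.single a u : κ → ℝ)} := by
    intro a u hu
    refine ⟨LinearMap.id - (LinearMap.single ℝ (fun _ => ℝ) a) ∘ₗ LinearMap.proj a, ?_, ?_, ?_⟩
    · intro c
      rcases eq_or_ne c a with rfl | h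
      · exact ⟨c, 0, by simp [IsSign], by simp⟩
      · exact ⟨c, 1, by simp [IsSign], by simp [Pi.single_eq_of_ne h.symm]⟩
    · simp
    · intro w hw
      simp only [LinearMap.mem_ker, LinearMap.sub_apply, LinearMap.id_apply,
        LinearMap.comp_apply, LinearMap.proj_apply, LinearMap.coe_single, sub_eq_zero] at hw
      rw [Submodule.mem_span_singleton]
      refine ⟨w a / u, ?_⟩
      rw [← Pi.single_smul, smul_eq_mul, div_mul_cancel₀ _ hu, ← hw]
  obtain ⟨a, b, s, t, hs, ht, rfl⟩ := hv
  rcases eq_or_ne a b with rfl | hab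
  · rw [← Pi.single_add] at h0 ⊢
    exact key a _ fun h => h0 (by rw [h, Pi.single_zero])
  rcases eq_or_ne s 0 with rfl | hs0
  · rw [Pi.single_zero, zero_add] at h0 ⊢
    exact key b _ fun h => h0 (by rw [h, Pi.single_zero])
  rcases eq_or_ne t 0 with rfl | ht0
  · rw [Pi.single_zero, add_zero] at h0 ⊢
    exact key a _ fun h => h0 (by rw [h, Pi.single_zero])
  have hss : s * s = 1 := by rcases hs with rfl | rfl | rfl <;> simp_all
  have htt : t * t = 1 := by rcases ht with rfl | rfl | rfl <;> simp_all
  -- for `s e_a + t e_b`: substitute `-st e_a` for `e_b`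
  refine ⟨LinearMap.id - (LinearMap.single ℝ (fun _ => ℝ) b + (s * t) •
    LinearMap.single ℝ (fun _ => ℝ) a) ∘ₗ LinearMap.proj b, ?_, ?_, ?_⟩
  · intro c
    rcases eq_or_ne c b with rfl | h
    · refine ⟨a, -(s * t), (hs.mul ht).neg, ?_⟩
      rw [Pi.single_neg, single_eq_smul a (s * t)]
      simp
    · exact ⟨c, 1, by simp [IsSign], by simp [Pi.single_eq_of_ne h.symm]⟩
  · have : s * (t * t) = s := by rw [htt, mul_one]
    simp only [LinearMap.sub_apply, LinearMap.id_apply, LinearMap.comp_apply, LinearMap.proj_apply,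
      LinearMap.add_apply, LinearMap.smul_apply, LinearMap.coe_single, Pi.add_apply,
      Pi.single_eq_same, Pi.single_eq_of_ne hab.symm, zero_add, ← Pi.single_smul, smul_eq_mul,
      mul_assoc, this]
    abel
  · intro w hw
    simp only [LinearMap.mem_ker, LinearMap.sub_apply, LinearMap.id_apply, LinearMap.comp_apply,
      LinearMap.proj_apply, LinearMap.add_apply, LinearMap.smul_apply, LinearMap.coe_single,
      sub_eq_zero, ← Pi.single_smul, smul_eq_mul] at hw
    rw [Submodule.mem_span_singleton]
    refine ⟨t * w b, ?_⟩
    rw [smul_add, ← Pi.single_smul, ← Pi.single_smul, smul_eq_mul, smul_eq_mul, hw, add_comm]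
    congr 2
    · simp [hab]; linear_combination w b * htt
    · simp [hab]; ring

/-- Over the integers modulo an odd number `m`, vectors `±e_a ± e_b`, `±e_a`, `±2e_a` are as
independent as they are over `ℝ`. -/
lemma dvd_of_sum_smul_eq_of_isShortSum {κ : Type*} [Fintype κ] [DecidableEq κ] {m : ℕ}
    (hm : Odd m) : ∀ {k : ℕ} (v : Fin k → κ → ℝ), (∀ i, IsShortSum (v i)) →
      LinearIndependent ℝ v → ∀ (x : Fin k → ℤ) (w : κ → ℝ), IsIntegral w →
      ∑ i, (x i : ℝ) • v i = (m : ℝ) • w → ∀ i, (m : ℤ) ∣ x i := by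
  intro k
  induction k with
  | zero => exact fun _ _ _ _ _ _ _ i => i.elim0
  | succ k ih =>
    intro v hv hli x w hw hsum
    have h0 : v 0 ≠ 0 := hli.ne_zero 0
    obtain ⟨T, hT, hT0, hker⟩ := (hv 0).exists_elimination h0
    rw [Fin.sum_univ_succ] at hsum
    obtain ⟨hli', hnot⟩ := linearIndependent_finSucc.1 hli
    have htail : ∀ i : Fin k, (m : ℤ) ∣ x i.succ := by
      refine ih (fun i => T (v i.succ)) (fun i => hT.isShortSum (hv _)) ?_ (fun i => x i.succ)
        (T w) (hT.isIntegral hw) ?_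
      · exact LinearIndependent.map hli'
          (((Submodule.disjoint_span_singleton' h0).2 hnot).mono_right hker)
      · have := congrArg T hsum
        rwa [map_add, map_smul, hT0, smul_zero, zero_add, map_sum, map_smul,
          Finset.sum_congr rfl fun i _ => map_smul T (x i.succ : ℝ) (v i.succ)] at this
    intro i
    refine Fin.cases ?_ htail i
    choose y hy using htail
    have hint : IsIntegral (w - ∑ i, (y i : ℝ) • v i.succ) :=
      hw.sub (IsIntegral.sum _ fun i => (hv _).isIntegral.int_smul _)
    have heq : (x 0 : ℝ) • v 0 = (m : ℝ) • (w - ∑ i, (y i : ℝ) • v i.succ) := by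
      rw [smul_sub, ← hsum, Finset.smul_sum]
      have : ∀ i : Fin k, (m : ℝ) • (y i : ℝ) • v i.succ = (x i.succ : ℝ) • v i.succ := by
        intro i
        rw [hy i, smul_smul]
        push_cast
        rfl
      rw [Finset.sum_congr rfl fun i _ => this i]
      abel
    -- some coordinate of `v 0` is a unit modulo `m`
    obtain ⟨c, u, hu, hvc⟩ : ∃ (c : κ) (u : ℤ), IsCoprime u (m : ℤ) ∧ v 0 c = u := by
      have h2 : IsCoprime (2 : ℤ) (m : ℤ) := by
        rw [Int.isCoprime_iff_gcd_eq_one]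
        exact Nat.coprime_two_left.2 hm
      obtain ⟨a, b, s, t, hs, ht, hst⟩ := hv 0
      rw [hst] at h0
      rcases eq_or_ne a b with rfl | hab
      · rw [← Pi.single_add] at h0 hst
        have hne : s + t ≠ 0 := fun h => h0 (by rw [h, Pi.single_zero])
        have hval : v 0 a = s + t := by rw [hst, Pi.single_eq_same]
        rcases hs with rfl | rfl | rfl <;> rcases ht with rfl | rfl | rfl <;> norm_num at hne
        exacts [⟨a, -2, h2.neg_left, by rw [hval]; norm_num⟩,
          ⟨a, -1, isCoprime_one_left.neg_left, by rw [hval]; norm_num⟩,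
          ⟨a, -1, isCoprime_one_left.neg_left, by rw [hval]; norm_num⟩,
          ⟨a, 1, isCoprime_one_left, by rw [hval]; norm_num⟩,
          ⟨a, 1, isCoprime_one_left, by rw [hval]; norm_num⟩,
          ⟨a, 2, h2, by rw [hval]; norm_num⟩]
      · have unit : ∀ {r : ℝ}, IsSign r → r ≠ 0 → ∃ u : ℤ, IsCoprime u (m : ℤ) ∧ r = u := by
          intro r hr hr0
          rcases hr with rfl | rfl | rfl
          exacts [⟨-1, isCoprime_one_left.neg_left, by simp⟩, absurd rfl hr0,
            ⟨1, isCoprime_one_left, by simp⟩]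
        by_cases hs0 : s = 0
        · have ht0 : t ≠ 0 := by
            rintro rfl
            exact h0 (by simp [hs0])
          obtain ⟨u, hu, hu'⟩ := unit ht ht0
          exact ⟨b, u, hu, by rw [hst, ← hu']; simp [hab.symm]⟩
        · obtain ⟨u, hu, hu'⟩ := unit hs hs0
          exact ⟨a, u, hu, by rw [hst, ← hu']; simp [hab]⟩
    obtain ⟨z, hz⟩ := hint c
    have := congrFun heq c
    simp only [Pi.smul_apply, smul_eq_mul] at this
    rw [hvc, hz] at this
    refine hu.symm.dvd_of_dvd_mul_right ⟨z, ?_⟩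
    exact_mod_cast this

/-! ### Integral weights and coweights -/

section Integral

variable {ι M N : Type*} [AddCommGroup M] [Module ℝ M] [AddCommGroup N] [Module ℝ N]
  {P : RootPairing ι ℝ M N}

lemma cast_cartanMatrix [P.IsCrystallographic] (b : P.Base) (i j : b.support) :
    (b.cartanMatrix i j : ℝ) = P.pairing i j :=
  b.algebraMap_cartanMatrixIn_apply ℤ i j

lemma exists_coweight_of_base [P.IsRootSystem] (b : P.Base) (g : b.support → ℝ) :
    ∃ f : N, ∀ j : b.support, P.toLinearMap (P.root j) f = g j := by
  let φ : Module.Dual ℝ M := b.toWeightBasis.constr ℝ g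
  refine ⟨P.flip.toPerfPair.symm φ, fun j => ?_⟩
  have h : P.flip.toPerfPair (P.flip.toPerfPair.symm φ) (P.root j) = φ (P.root j) := by
    rw [LinearEquiv.apply_symm_apply]
  have h' : φ (P.root j) = g j := by
    rw [← b.toWeightBasis_apply, Basis.constr_basis]
  rw [← h', ← h]
  rfl

lemma exists_int_of_base {b : P.Base} {f : N}
    (hf : ∀ j : b.support, ∃ z : ℤ, P.toLinearMap (P.root j) f = z) (i : ι) :
    ∃ z : ℤ, P.toLinearMap (P.root i) f = z := by
  have hi := b.root_mem_span_int i
  generalize P.root i = v at hi ⊢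
  induction hi using Submodule.span_induction with
  | mem x hx =>
    obtain ⟨j, hj, rfl⟩ := hx
    exact hf ⟨j, hj⟩
  | zero => exact ⟨0, by simp⟩
  | add x y _ _ hx hy =>
    obtain ⟨u, hu⟩ := hx
    obtain ⟨v, hv⟩ := hy
    exact ⟨u + v, by simp [hu, hv]⟩
  | smul a x _ hx =>
    obtain ⟨u, hu⟩ := hx
    exact ⟨a * u, by simp [hu]⟩

lemma exists_weight_of_base [P.IsRootSystem] (b : P.Base) (g : b.support → ℝ) :
    ∃ x : M, ∀ j : b.support, P.toLinearMap x (P.coroot j) = g j :=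
  exists_coweight_of_base (P := P.flip) b.flip g

lemma exists_int_coroot_of_base {b : P.Base} {x : M}
    (hx : ∀ j : b.support, ∃ z : ℤ, P.toLinearMap x (P.coroot j) = z) (i : ι) :
    ∃ z : ℤ, P.toLinearMap x (P.coroot i) = z :=
  exists_int_of_base (P := P.flip) (b := b.flip) hx i

end Integral

/-! ### Squared lengths of roots -/

section Lengths

variable {ι M N : Type*} [Fintype ι] [AddCommGroup M] [Module ℝ M] [AddCommGroup N] [Module ℝ N]
  {P : RootPairing ι ℝ M N}

lemma rootForm_root_self_pos (i : ι) : 0 < P.RootForm (P.root i) (P.root i) :=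
  P.rootForm_pos_of_ne_zero (Submodule.subset_span ⟨i, rfl⟩) (P.ne_zero i)

lemma rootForm_comm (x y : M) : P.RootForm x y = P.RootForm y x :=
  P.rootForm_symmetric.eq x y

lemma pairing_mul_rootForm_root_self (i j : ι) :
    P.pairing j i * P.RootForm (P.root i) (P.root i) =
      P.pairing i j * P.RootForm (P.root j) (P.root j) :=
  P.toInvariantForm.pairing_mul_eq_pairing_mul_swap i j

/-- The squared lengths of the simple roots of `b` are the multiples of `c` by the numbers `d`. -/
def IsLengthScale (b : P.Base) (d : b.support → ℕ) (c : ℝ) : Prop :=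
  ∀ i : b.support, P.RootForm (P.root i) (P.root i) = c * d i

variable [P.IsCrystallographic]

/-- By connectedness of the Dynkin diagram, positive integers that symmetrize the Cartan matrix are
proportional to the squared lengths of the simple roots. -/
lemma exists_isLengthScale [P.IsReduced] [P.IsIrreducible] (b : P.Base) {d : b.support → ℕ}
    (hd : ∀ i, 0 < d i)
    (hsymm : ∀ i j, (d i : ℤ) * b.cartanMatrix j i = (d j : ℤ) * b.cartanMatrix i j)
    (i₀ : b.support) : ∃ c, 0 < c ∧ IsLengthScale b d c := by
  refine ⟨P.RootForm (P.root i₀) (P.root i₀) / d i₀,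
    div_pos (rootForm_root_self_pos _) (by exact_mod_cast hd _), fun j => ?_⟩
  set c := P.RootForm (P.root i₀) (P.root i₀) / d i₀
  refine b.induction_on_cartanMatrix
    (fun j => P.RootForm (P.root j) (P.root j) = c * d j) (i := i₀) (j := j) ?_ ?_
  · have : (d i₀ : ℝ) ≠ 0 := by exact_mod_cast (hd i₀).ne'
    simp only [c]
    field_simp
  · intro i j hi hij
    have h1 := pairing_mul_rootForm_root_self (P := P) i j
    have h2 : (d i : ℝ) * P.pairing j i = d j * P.pairing i j := by
      rw [← cast_cartanMatrix, ← cast_cartanMatrix]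
      exact_mod_cast hsymm i j
    have hji : P.pairing j i ≠ 0 := by rwa [ne_eq, ← b.cartanMatrix_apply_eq_zero_iff_pairing]
    have hne : P.pairing i j ≠ 0 := fun h => hji <| by
      rwa [P.pairing_eq_zero_iff] at h
    apply mul_left_cancel₀ hne
    rw [← h1, hi]
    linear_combination c * h2

lemma exists_mem_support_rootForm_eq [P.IsReduced] (b : P.Base) (i : ι) :
    ∃ j : b.support, P.RootForm (P.root i) (P.root i) = P.RootForm (P.root j) (P.root j) := by
  refine b.induction_reflect i (p := fun i => ∃ j : b.support,
    P.RootForm (P.root i) (P.root i) = P.RootForm (P.root j) (P.root j)) ?_ ?_ ?_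
  · rintro i ⟨j, hj⟩
    exact ⟨j, by rw [← hj, P.root_reflectionPerm, P.rootForm_reflection_reflection_apply]⟩
  · exact fun i hi => ⟨⟨i, hi⟩, rfl⟩
  · rintro i k ⟨j, hj⟩ -
    exact ⟨j, by rw [← hj, P.root_reflectionPerm, P.rootForm_reflection_reflection_apply]⟩

/-- The squared lengths of the simple roots of any base are those of all roots.  So the unit of length
of the coprime symmetrizer `d` is the squared length of the shortest roots, and a symmetrizer of
another base which has the value `1` refers to the same unit. -/
lemma IsSymmetrizer.lengthScale_unique [P.IsReduced] {b b' : P.Base}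
    {d : b.support → ℕ} (hd : IsSymmetrizer b d) {c : ℝ} (hc : 0 < c) (hdc : IsLengthScale b d c)
    {d' : b'.support → ℕ} {c' : ℝ} (hdc' : IsLengthScale b' d' c')
    {i' : b'.support} (hi' : d' i' = 1) : c' = c := by
  obtain ⟨j, hj⟩ := exists_mem_support_rootForm_eq b i'
  rw [hdc', hdc j, hi', Nat.cast_one, mul_one] at hj
  suffices h : d j = 1 by rw [hj, h, Nat.cast_one, mul_one]
  refine Nat.dvd_one.1 (hd.gcd_eq_one ▸ Finset.dvd_gcd fun i _ => ?_)
  obtain ⟨k, hk⟩ := exists_mem_support_rootForm_eq b' i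
  rw [hdc, hdc' k, hj, mul_assoc] at hk
  refine ⟨d' k, ?_⟩
  exact_mod_cast mul_left_cancel₀ hc.ne' hk

end Lengths

/-! ### Coordinates of coroots, and the functionals `Y` -/

section Coordinates

variable {ι M N : Type*} [Fintype ι] [AddCommGroup M] [Module ℝ M] [AddCommGroup N] [Module ℝ N]
  {P : RootPairing ι ℝ M N}

/-- The coordinates of a coroot with respect to the simple coroots, in terms of those of the root. -/
lemma smul_coroot_eq_sum {b : P.Base} {d : b.support → ℕ} {c : ℝ} (hc : 0 < c)
    (hdc : IsLengthScale b d c) {i : ι} {r : ℝ}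
    (hr : P.RootForm (P.root i) (P.root i) = c * r) {y : b.support → ℝ}
    (hy : P.root i = ∑ j, y j • P.root j) :
    r • P.coroot i = ∑ j, (d j * y j) • P.coroot j := by
  have h1 := P.rootForm_self_smul_coroot i
  rw [hr, ← Nat.cast_smul_eq_nsmul ℝ, hy, map_sum, Finset.smul_sum] at h1
  have h2 : ∀ j : b.support, ((2 : ℕ) : ℝ) • P.Polarization (y j • P.root j) =
      c • ((d j * y j) • P.coroot j) := by
    intro j
    have := P.rootForm_self_smul_coroot j
    rw [hdc, ← Nat.cast_smul_eq_nsmul ℝ] at this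
    rw [map_smul, smul_comm, ← this, smul_smul, smul_smul]
    congr 1
    ring
  rw [Finset.sum_congr rfl fun j _ => h2 j, ← Finset.smul_sum, mul_smul] at h1
  exact smul_right_injective N hc.ne' h1

/-- The coroots with the indices `γ` are linearly independent modulo `m` in the coroot lattice. -/
def IsIndependentMod (P : RootPairing ι ℝ M N) {k : ℕ} (m : ℕ) (γ : Fin k → ι) : Prop :=
  ∀ (x : Fin k → ℤ), ∀ y ∈ Submodule.span ℤ (Set.range P.coroot),
    ∑ i, (x i : ℝ) • P.coroot (γ i) = (m : ℝ) • y → ∀ i, (m : ℤ) ∣ x i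

/-- The value of `Y_j` on a root `γ` is the coefficient of `α_j^∨` in `r γ^∨`, where `r` is the
squared length of `γ` in terms of the shortest roots.  So the equations say that a combination of
coroots is divisible by `m` in the coroot lattice. -/
lemma eq_zero_of_isIndependentMod [P.IsRootSystem] {b : P.Base} {d : b.support → ℕ} {c : ℝ}
    (hc : 0 < c) (hdc : IsLengthScale b d c) {k : ℕ} {γ : Fin k → ι} {m : ℕ}
    (hγ : IsIndependentMod P m γ) {r : Fin k → ℕ}
    (hr : ∀ i, P.RootForm (P.root (γ i)) (P.root (γ i)) = c * r i)
    (hrm : ∀ i, (r i).Coprime m) {p : b.support → ℤ} {x : Fin k → ℤ}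
    (hx : ∀ i, x i ∈ Set.Icc (-(m : ℤ) + 1) (m - 1))
    (hsys : ∀ j, Y b d j (∑ i, (x i : ℝ) • P.root (γ i)) = (m : ℝ) * (p j : ℝ)) :
    ∀ i, x i = 0 := by
  have hcoroot : ∀ i, (r i : ℝ) • P.coroot (γ i) =
      ∑ j, (Y b d j (P.root (γ i))) • P.coroot j := fun i => by
    refine smul_coroot_eq_sum hc hdc (hr i)
      (y := fun j => b.toWeightBasis.coord j (P.root (γ i))) ?_
    have := b.toWeightBasis.sum_repr (P.root (γ i))
    simpa using this.symm
  have hdvd : ∀ i, (m : ℤ) ∣ x i * r i := by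
    refine hγ (fun i => x i * r i) (∑ j, (p j : ℝ) • P.coroot j) ?_ ?_
    · refine Submodule.sum_mem _ fun j _ => ?_
      rw [Int.cast_smul_eq_zsmul]
      exact Submodule.smul_mem _ _ (Submodule.subset_span ⟨j, rfl⟩)
    · calc ∑ i, ((x i * r i : ℤ) : ℝ) • P.coroot (γ i)
          = ∑ i, ∑ j, ((x i : ℝ) * Y b d j (P.root (γ i))) • P.coroot j := by
            refine Finset.sum_congr rfl fun i _ => ?_
            push_cast
            rw [mul_smul, hcoroot, Finset.smul_sum]
            simp only [mul_smul]
        _ = ∑ j, (Y b d j (∑ i, (x i : ℝ) • P.root (γ i))) • P.coroot j := by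
            rw [Finset.sum_comm]
            refine Finset.sum_congr rfl fun j _ => ?_
            rw [map_sum, Finset.sum_smul]
            simp only [map_smul, smul_eq_mul]
        _ = (m : ℝ) • ∑ j, (p j : ℝ) • P.coroot j := by
            simp only [hsys, mul_smul, Finset.smul_sum]
  intro i
  have hco : IsCoprime (m : ℤ) (r i : ℤ) := (Nat.isCoprime_iff_coprime.2 (hrm i)).symm
  refine Int.eq_zero_of_abs_lt_dvd (hco.dvd_of_dvd_mul_right (hdvd i)) ?_
  have := hx i
  rw [Set.mem_Icc] at this
  rw [abs_lt]
  omega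

end Coordinates

/-! ### Products of reflections -/

section Reflections

variable {ι M N : Type*} [AddCommGroup M] [Module ℝ M] [AddCommGroup N] [Module ℝ N]

/-- The product `s_{γ_1} ⋯ s_{γ_k}` of reflections. -/
noncomputable def reflectionProd (P : RootPairing ι ℝ M N) {k : ℕ} (γ : Fin k → ι) : M ≃ₗ[ℝ] M :=
  (List.ofFn fun i => P.reflection (γ i)).prod

variable {P : RootPairing ι ℝ M N}

lemma firstFactor_mul_secondFactor {k : ℕ} (n : ℕ) (γ : Fin k → ι) :
    firstFactor P n γ * secondFactor P n γ = reflectionProd P γ := by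
  rw [firstFactor, secondFactor, ← List.prod_append, List.take_append_drop, reflectionProd]

lemma reflectionProd_succ_apply {k : ℕ} (γ : Fin (k + 1) → ι) (x : M) :
    reflectionProd P γ x = P.reflection (γ 0) (reflectionProd P (Fin.tail γ) x) := by
  simp only [reflectionProd, List.ofFn_succ, List.prod_cons, LinearEquiv.mul_apply]
  rfl

/-- `1 - s_{γ_1} ⋯ s_{γ_k}` is `x ↦ ∑ ⟨x, γ_t^∨⟩ v_t`, where `v_t = s_{γ_1} ⋯ s_{γ_{t-1}} γ_t` is a
root and is obtained from `γ` by an integral unitriangular transformation. -/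
lemma exists_sub_reflectionProd_eq_sum [P.IsCrystallographic] : ∀ {k : ℕ} (γ : Fin k → ι),
    ∃ v : Fin k → ι,
      (∀ x, x - reflectionProd P γ x = ∑ t, P.toLinearMap x (P.coroot (γ t)) • P.root (v t)) ∧
      ∀ t, ∃ z : Fin k → ℤ, (∀ u, t ≤ u → z u = 0) ∧
        P.root (v t) = P.root (γ t) + ∑ u, (z u : ℝ) • P.root (γ u) := by
  intro k
  induction k with
  | zero => exact fun γ => ⟨γ, fun x => by simp [reflectionProd], fun t => t.elim0⟩
  | succ k ih =>
    intro γ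
    obtain ⟨v, hv, hz⟩ := ih (Fin.tail γ)
    refine ⟨Fin.cons (γ 0) fun t => P.reflectionPerm (γ 0) (v t), fun x => ?_, fun t => ?_⟩
    · rw [reflectionProd_succ_apply, Fin.sum_univ_succ]
      have h : reflectionProd P (Fin.tail γ) x = x - ∑ t, P.toLinearMap x
          (P.coroot (Fin.tail γ t)) • P.root (v t) := by rw [← hv x, sub_sub_cancel]
      rw [h, map_sub, map_sum, P.reflection_apply]
      simp only [Fin.cons_zero, Fin.cons_succ, P.root_reflectionPerm, map_smul]
      rw [sub_sub, sub_sub_cancel]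
      rfl
    · refine Fin.cases ⟨0, fun _ _ => rfl, by simp⟩ (fun t => ?_) t
      obtain ⟨z, hz0, hzt⟩ := hz t
      refine ⟨Fin.cons (-P.pairingIn ℤ (v t) (γ 0)) z, fun u hu => ?_, ?_⟩
      · refine Fin.cases (fun h => absurd h (by simp)) (fun u h => ?_) u hu
        simpa using hz0 u (by simpa using h)
      · have hp : P.pairing (v t) (γ 0) = (P.pairingIn ℤ (v t) (γ 0) : ℝ) :=
          (P.algebraMap_pairingIn ℤ _ _).symm
        rw [Fin.cons_succ, P.root_reflectionPerm, P.reflection_apply_root, Fin.sum_univ_succ, hp,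
          hzt]
        simp only [Fin.cons_zero, Fin.cons_succ, Fin.tail, Int.cast_neg, neg_smul]
        abel

end Reflections

/-! ### Automorphisms of the root system -/

section Automorphisms

variable {ι M N : Type*} [AddCommGroup M] [Module ℝ M] [AddCommGroup N] [Module ℝ N]
  {P : RootPairing ι ℝ M N}

lemma toLinearMap_weightEquiv (g : P.Aut) (x : M) (f : N) :
    P.toLinearMap (RootPairing.Equiv.weightEquiv P P g x) f =
      P.toLinearMap x (RootPairing.Equiv.coweightEquiv P P g f) :=
  LinearMap.congr_fun (RootPairing.Hom.weight_coweight_transpose_apply P P f g.toHom) x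

lemma exists_aut_of_mem_weylGroup {w : M ≃ₗ[ℝ] M} (hw : w ∈ weylGroup P) :
    ∃ g : P.Aut, RootPairing.Equiv.weightEquiv P P g = w := by
  rw [weylGroup, ← P.range_weylGroup_weightHom] at hw
  obtain ⟨g, rfl⟩ := hw
  exact ⟨g, rfl⟩

lemma coroot'_weightEquiv (g : P.Aut) (i : ι) (x : M) :
    P.coroot' (g.indexEquiv i) (RootPairing.Equiv.weightEquiv P P g x) = P.coroot' i x := by
  change P.toLinearMap _ (P.coroot _) = P.toLinearMap _ (P.coroot _)
  rw [toLinearMap_weightEquiv, RootPairing.Equiv.coweightEquiv_apply,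
    RootPairing.Hom.coroot_coweightMap_apply, Equiv.symm_apply_apply]

lemma root_indexEquiv (g : P.Aut) (i : ι) :
    P.root (g.indexEquiv i) = RootPairing.Equiv.weightEquiv P P g (P.root i) := by
  rw [RootPairing.Equiv.weightEquiv_apply, RootPairing.Hom.root_weightMap_apply]

lemma reflection_indexEquiv (g : P.Aut) (i : ι) :
    P.reflection (g.indexEquiv i) = RootPairing.Equiv.weightEquiv P P g * P.reflection i *
      (RootPairing.Equiv.weightEquiv P P g)⁻¹ := by
  rw [eq_mul_inv_iff_mul_eq]
  ext x
  rw [LinearEquiv.mul_apply, LinearEquiv.mul_apply, P.reflection_apply, P.reflection_apply,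
    coroot'_weightEquiv, root_indexEquiv, map_sub, map_smul]

lemma reflectionProd_indexEquiv (g : P.Aut) {k : ℕ} (β : Fin k → ι) :
    reflectionProd P (g.indexEquiv ∘ β) = RootPairing.Equiv.weightEquiv P P g *
      reflectionProd P β * (RootPairing.Equiv.weightEquiv P P g)⁻¹ := by
  rw [← MulAut.conj_apply, reflectionProd, reflectionProd, map_list_prod, List.map_ofFn]
  congr 2
  funext i
  exact reflection_indexEquiv g (β i)

lemma rootForm_weightEquiv [Fintype ι] (g : P.Aut) (x y : M) :
    P.RootForm (RootPairing.Equiv.weightEquiv P P g x) (RootPairing.Equiv.weightEquiv P P g y) =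
      P.RootForm x y := by
  rw [P.rootForm_apply_apply, P.rootForm_apply_apply, ← Equiv.sum_comp g.indexEquiv]
  simp only [coroot'_weightEquiv]

end Automorphisms

/-! ### Dual systems and the independence of the presentation -/

section DualSystems

variable {ι M N : Type*} [AddCommGroup M] [Module ℝ M] [AddCommGroup N] [Module ℝ N]

/-- Integral coweights `f_a` and integral weights `x_a` with `⟨β_t, f_a⟩ = δ_{at} y_a` and
`⟨x_a, β_t^∨⟩ = δ_{at} z_a`, where the nonzero integers `y_a` and `z_a` are prime to `m`.  Such a
system shows that the roots `β_t`, and the coroots `β_t^∨`, are linearly independent modulo `m`. -/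
structure DualSystem (P : RootPairing ι ℝ M N) (m : ℕ) {k : ℕ} (β : Fin k → ι) where
  coweight : Fin k → N
  weight : Fin k → M
  coweightValue : Fin k → ℤ
  weightValue : Fin k → ℤ
  coweight_int : ∀ a i, ∃ z : ℤ, P.toLinearMap (P.root i) (coweight a) = z
  weight_int : ∀ a i, ∃ z : ℤ, P.toLinearMap (weight a) (P.coroot i) = z
  coweight_apply : ∀ a t, P.toLinearMap (P.root (β t)) (coweight a) =
    if a = t then (coweightValue a : ℝ) else 0
  weight_apply : ∀ a t, P.toLinearMap (weight a) (P.coroot (β t)) =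
    if a = t then (weightValue a : ℝ) else 0
  coweightValue_ne_zero : ∀ a, coweightValue a ≠ 0
  weightValue_ne_zero : ∀ a, weightValue a ≠ 0
  isCoprime_coweightValue : ∀ a, IsCoprime (coweightValue a) (m : ℤ)
  isCoprime_weightValue : ∀ a, IsCoprime (weightValue a) (m : ℤ)

variable {P : RootPairing ι ℝ M N} {m k : ℕ} {β : Fin k → ι}

/-- The image of a dual system under an automorphism of the root system. -/
noncomputable def DualSystem.map (D : DualSystem P m β) (g : P.Aut) :
    DualSystem P m (g.indexEquiv ∘ β) where
  coweight a := (RootPairing.Equiv.coweightEquiv P P g).symm (D.coweight a)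
  weight a := RootPairing.Equiv.weightEquiv P P g (D.weight a)
  coweightValue := D.coweightValue
  weightValue := D.weightValue
  coweight_int a i := by
    obtain ⟨z, hz⟩ := D.coweight_int a (g.indexEquiv.symm i)
    refine ⟨z, ?_⟩
    rw [← Equiv.apply_symm_apply g.indexEquiv i, root_indexEquiv, toLinearMap_weightEquiv,
      LinearEquiv.apply_symm_apply, hz]
  weight_int a i := by
    obtain ⟨z, hz⟩ := D.weight_int a (g.indexEquiv.symm i)
    refine ⟨z, ?_⟩
    rw [toLinearMap_weightEquiv, RootPairing.Equiv.coweightEquiv_apply,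
      RootPairing.Hom.coroot_coweightMap_apply, hz]
  coweight_apply a t := by
    rw [Function.comp_apply, root_indexEquiv, toLinearMap_weightEquiv,
      LinearEquiv.apply_symm_apply, D.coweight_apply]
  weight_apply a t := by
    rw [toLinearMap_weightEquiv, RootPairing.Equiv.coweightEquiv_apply,
      RootPairing.Hom.coroot_coweightMap_apply, Function.comp_apply, Equiv.symm_apply_apply,
      D.weight_apply]
  coweightValue_ne_zero := D.coweightValue_ne_zero
  weightValue_ne_zero := D.weightValue_ne_zero
  isCoprime_coweightValue := D.isCoprime_coweightValue
  isCoprime_weightValue := D.isCoprime_weightValue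

lemma DualSystem.linearIndependent (D : DualSystem P m β) :
    LinearIndependent ℝ fun t => P.root (β t) := by
  rw [Fintype.linearIndependent_iff]
  intro c hc a
  have := congrArg (fun x => P.toLinearMap x (D.coweight a)) hc
  simp only [map_sum, map_smul, LinearMap.sum_apply, LinearMap.smul_apply, D.coweight_apply,
    map_zero, LinearMap.zero_apply, smul_eq_mul, mul_ite, mul_zero, Finset.sum_ite_eq,
    Finset.mem_univ, if_true] at this
  exact (mul_eq_zero.1 this).resolve_right (by exact_mod_cast D.coweightValue_ne_zero a)

/-- The values of the `f_a` on a unitriangular transform of `β` form a triangular matrix. -/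
lemma DualSystem.exists_triangular (D : DualSystem P m β) {v : Fin k → ι}
    (hv : ∀ t, ∃ z : Fin k → ℤ, (∀ u, t ≤ u → z u = 0) ∧
      P.root (v t) = P.root (β t) + ∑ u, (z u : ℝ) • P.root (β u)) :
    ∃ V : Matrix (Fin k) (Fin k) ℤ,
      (∀ a t, P.toLinearMap (P.root (v t)) (D.coweight a) = V a t) ∧
      V.det = ∏ a, D.coweightValue a := by
  choose z hz hv using hv
  refine ⟨Matrix.of fun a t => (if a = t then D.coweightValue a else 0) +
    z t a * D.coweightValue a, fun a t => ?_, ?_⟩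
  · rw [hv]
    simp [D.coweight_apply]
  · rw [Matrix.det_of_isUpperTriangular]
    · refine Finset.prod_congr rfl fun a _ => ?_
      simp [hz a a le_rfl]
    · intro a t hat
      have hat' : t < a := hat
      simp [hat'.ne', hz t a hat'.le]

/-- If the products of the reflections in `β` and in `γ` agree, then linear independence modulo `m`
passes from `β` to `γ`: up to factors prime to `m`, the determinant of the matrix
`⟨(1 - s) x_b, f_a⟩` is `1` by its expression through `β`, and is divisible by the determinant of
the matrix `⟨x_b, γ_t^∨⟩` by its expression through `γ`. -/
lemma DualSystem.isIndependentMod [Fintype ι] [P.IsCrystallographic] (D : DualSystem P m β)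
    {γ : Fin k → ι} (h : reflectionProd P β = reflectionProd P γ) : IsIndependentMod P m γ := by
  obtain ⟨v, hv, hvβ⟩ := exists_sub_reflectionProd_eq_sum (P := P) β
  obtain ⟨w, hw, -⟩ := exists_sub_reflectionProd_eq_sum (P := P) γ
  obtain ⟨V, hV, hVdet⟩ := D.exists_triangular hvβ
  choose W hW using fun a t => D.coweight_int a (w t)
  choose C hC using fun t b => D.weight_int b (γ t)
  have hmul : V * Matrix.diagonal D.weightValue = Matrix.of W * Matrix.of C := by
    ext a b
    have := congrArg (fun x => P.toLinearMap x (D.coweight a))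
      ((hv (D.weight b)).symm.trans ((congrArg (fun s : M ≃ₗ[ℝ] M => D.weight b - s (D.weight b))
        h).trans (hw (D.weight b))))
    simp only [map_sum, map_smul, LinearMap.sum_apply, LinearMap.smul_apply, hV, hW, hC,
      D.weight_apply, smul_eq_mul, ite_mul, zero_mul, Finset.sum_ite_eq, Finset.mem_univ,
      if_true] at this
    rw [Matrix.mul_diagonal, Matrix.mul_apply, mul_comm]
    simp only [Matrix.of_apply]
    simp only [mul_comm (W _ _)]
    exact_mod_cast this
  have hdet : IsCoprime (Matrix.of C).det (m : ℤ) := by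
    have h1 := congrArg Matrix.det hmul
    rw [Matrix.det_mul, Matrix.det_mul, Matrix.det_diagonal, hVdet] at h1
    have h2 : IsCoprime ((∏ a, D.coweightValue a) * ∏ a, D.weightValue a) (m : ℤ) :=
      (IsCoprime.prod_left fun a _ => D.isCoprime_coweightValue a).mul_left
        (IsCoprime.prod_left fun a _ => D.isCoprime_weightValue a)
    rw [h1] at h2
    exact h2.of_mul_left_right
  intro x y hy hxy
  have hyint : ∀ b, ∃ z : ℤ, P.toLinearMap (D.weight b) y = z := by
    intro b
    clear hxy
    induction hy using Submodule.span_induction with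
    | mem y hy =>
      obtain ⟨i, rfl⟩ := hy
      exact D.weight_int b i
    | zero => exact ⟨0, by simp⟩
    | add y y' _ _ hy hy' =>
      obtain ⟨u, hu⟩ := hy
      obtain ⟨u', hu'⟩ := hy'
      exact ⟨u + u', by simp [hu, hu']⟩
    | smul c y _ hy =>
      obtain ⟨u, hu⟩ := hy
      exact ⟨c * u, by simp [hu]⟩
  choose z hz using hyint
  have hvec : Matrix.vecMul x (Matrix.of C) = (m : ℤ) • z := by
    ext b
    have := congrArg (P.toLinearMap (D.weight b)) hxy
    simp only [map_sum, map_smul, hC, hz, smul_eq_mul] at this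
    simp only [Matrix.vecMul, dotProduct, Matrix.of_apply, Pi.smul_apply, smul_eq_mul]
    exact_mod_cast this
  have hadj := congrArg (fun u => Matrix.vecMul u (Matrix.of C).adjugate) hvec
  simp only [Matrix.vecMul_vecMul, Matrix.mul_adjugate, Matrix.vecMul_smul, Matrix.vecMul_one,
    Matrix.smul_vecMul] at hadj
  intro i
  have hi := congrFun hadj i
  simp only [Pi.smul_apply, smul_eq_mul] at hi
  exact hdet.symm.dvd_of_dvd_mul_left ⟨_, hi⟩

/-- The span of `β` is the orthogonal complement of the fixed space of the product of the reflections
in `β`. -/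
lemma DualSystem.span_eq_movedSpace [Fintype ι] [P.IsRootSystem] [P.IsCrystallographic]
    (D : DualSystem P m β) :
    Submodule.span ℝ (Set.range fun t => P.root (β t)) = movedSpace P (reflectionProd P β) := by
  have hform : ∀ (i : ι) (y : M), 2 * P.RootForm y (P.root i) =
      P.RootForm (P.root i) (P.root i) * P.toLinearMap y (P.coroot i) := by
    intro i y
    have := congrArg (P.toLinearMap y) (P.rootForm_self_smul_coroot i)
    rw [map_smul, map_nsmul, P.toLinearMap_apply_apply_Polarization, smul_eq_mul,
      nsmul_eq_mul] at this
    rw [this, rootForm_comm y]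
    norm_num
  obtain ⟨v, hv, hvβ⟩ := exists_sub_reflectionProd_eq_sum (P := P) β
  have : FiniteDimensional ℝ M := Module.finite_def.2 (Submodule.fg_def.2
    ⟨Set.range P.root, Set.finite_range _, RootPairing.IsRootSystem.span_root_eq_top⟩)
  apply le_antisymm
  · rw [Submodule.span_le]
    rintro _ ⟨t, rfl⟩ y hy
    have hsum := hv y
    have hy' : reflectionProd P β y = y := hy
    rw [hy', sub_self] at hsum
    obtain ⟨V, hV, hVdet⟩ := D.exists_triangular hvβ
    have hzero : (V.map (Int.castRingHom ℝ)).mulVec (fun t => P.toLinearMap y (P.coroot (β t)))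
        = 0 := by
      ext a
      have := congrArg (fun x => P.toLinearMap x (D.coweight a)) hsum
      simp only [map_sum, map_smul, LinearMap.sum_apply, LinearMap.smul_apply, hV, map_zero,
        LinearMap.zero_apply, smul_eq_mul] at this
      rw [Pi.zero_apply, this]
      simp [Matrix.mulVec, dotProduct, mul_comm]
    have hdet : (V.map (Int.castRingHom ℝ)).det ≠ 0 := by
      rw [← RingHom.mapMatrix_apply, ← RingHom.map_det, hVdet]
      exact Int.cast_ne_zero.2 (Finset.prod_ne_zero_iff.2 fun a _ => D.coweightValue_ne_zero a)
    have h0 := congrFun (Matrix.eq_zero_of_mulVec_eq_zero hdet hzero) t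
    have := hform (β t) y
    rw [show P.toLinearMap y (P.coroot (β t)) = 0 from h0, mul_zero] at this
    simpa using this
  · intro x hx
    rw [← P.RootForm.orthogonal_orthogonal P.rootForm_nondegenerate P.rootForm_symmetric.isRefl
      (Submodule.span ℝ (Set.range fun t => P.root (β t)))]
    intro y hy
    refine hx y ?_
    have h0 : ∀ t, P.toLinearMap y (P.coroot (β t)) = 0 := by
      intro t
      have h1 : P.RootForm (P.root (β t)) y = 0 := hy _ (Submodule.subset_span ⟨t, rfl⟩)
      have h2 := hform (β t) y
      rw [rootForm_comm, h1, mul_zero] at h2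
      exact (mul_eq_zero.1 h2.symm).resolve_left (rootForm_root_self_pos _).ne'
    have := hv y
    simp only [h0, zero_smul, Finset.sum_const_zero] at this
    exact (sub_eq_zero.1 this).symm

/-- Two presentations as a product of reflections in linearly independent roots have the same number
of factors. -/
lemma DualSystem.card_eq [Fintype ι] [P.IsRootSystem] [P.IsCrystallographic]
    (D : DualSystem P m β) {l n : ℕ} {γ : Fin l → ι}
    (hγ : IsInvolutionPresentation P (reflectionProd P β) n γ) : k = l := by
  have h1 := finrank_span_eq_card D.linearIndependent
  have h2 := finrank_span_eq_card hγ.linearIndependent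
  rw [D.span_eq_movedSpace, ← hγ.span_eq, h2] at h1
  simpa using h1.symm

end DualSystems

/-! ### The classical types -/

section Classical

/-- The orthogonal reflection of `ℝ^κ` in the hyperplane orthogonal to `a`. -/
noncomputable def dotReflection {κ : Type*} [Fintype κ] (a : κ → ℝ) : (κ → ℝ) →ₗ[ℝ] (κ → ℝ) :=
  LinearMap.id -
    (∑ c, (2 / (a ⬝ᵥ a) * a c) • LinearMap.proj (R := ℝ) (φ := fun _ => ℝ) c).smulRight a

lemma dotReflection_apply {κ : Type*} [Fintype κ] (a v : κ → ℝ) :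
    dotReflection a v = v - (2 / (a ⬝ᵥ a) * (a ⬝ᵥ v)) • a := by
  simp [dotReflection, dotProduct, Finset.mul_sum, mul_assoc]

lemma single_add_single_dotProduct {κ : Type*} [Fintype κ] [DecidableEq κ] (x y x' y' : κ)
    (s t s' t' : ℝ) :
    (Pi.single x s + Pi.single y t : κ → ℝ) ⬝ᵥ (Pi.single x' s' + Pi.single y' t') =
      (if x = x' then s * s' else 0) + (if x = y' then s * t' else 0) +
      ((if y = x' then t * s' else 0) + (if y = y' then t * t' else 0)) := by
  simp only [dotProduct_add, dotProduct_single, Pi.add_apply, Pi.single_apply]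
  grind

/-- The reflection defined by one of the vectors `±e_a ± e_b`, `±e_a`, `±2e_a` permutes the
coordinate vectors up to signs. -/
lemma IsShortSum.isSignedMap_dotReflection {κ : Type*} [Fintype κ] [DecidableEq κ] {a : κ → ℝ}
    (ha : IsShortSum a) (h0 : a ≠ 0) : IsSignedMap (dotReflection a) := by
  have key : ∀ (x : κ) (u : ℝ), u ≠ 0 → IsSignedMap (dotReflection (Pi.single x u : κ → ℝ)) := by
    intro x u hu c
    rcases eq_or_ne c x with rfl | h
    · refine ⟨c, -1, by simp [IsSign], ?_⟩
      rw [dotReflection_apply, ← Pi.single_smul, ← Pi.single_sub]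
      congr 1
      simp
      field_simp
      norm_num
    · refine ⟨c, 1, by simp [IsSign], ?_⟩
      simp [dotReflection_apply, h.symm]
  obtain ⟨x, y, s, t, hs, ht, rfl⟩ := ha
  rcases eq_or_ne x y with rfl | hxy
  · rw [← Pi.single_add] at h0 ⊢
    exact key x _ fun h => h0 (by rw [h, Pi.single_zero])
  rcases eq_or_ne s 0 with rfl | hs0
  · rw [Pi.single_zero, zero_add] at h0 ⊢
    exact key y _ fun h => h0 (by rw [h, Pi.single_zero])
  rcases eq_or_ne t 0 with rfl | ht0
  · rw [Pi.single_zero, add_zero] at h0 ⊢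
    exact key x _ fun h => h0 (by rw [h, Pi.single_zero])
  have hss : s * s = 1 := by rcases hs with rfl | rfl | rfl <;> simp_all
  have htt : t * t = 1 := by rcases ht with rfl | rfl | rfl <;> simp_all
  intro c
  have hnorm : (Pi.single x s + Pi.single y t : κ → ℝ) ⬝ᵥ (Pi.single x s + Pi.single y t) = 2 := by
    rw [single_add_single_dotProduct]
    simp [hxy, hxy.symm, hss, htt]
    norm_num
  rcases eq_or_ne c x with rfl | hcx
  · refine ⟨y, -(s * t), (hs.mul ht).neg, ?_⟩
    have hdot : (Pi.single c s + Pi.single y t : κ → ℝ) ⬝ᵥ Pi.single c 1 = s := by simp [hxy]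
    rw [dotReflection_apply, hnorm, hdot, smul_add, ← Pi.single_smul, ← Pi.single_smul]
    norm_num [hss, Pi.single_neg]
  · rcases eq_or_ne c y with rfl | hcy
    · refine ⟨x, -(s * t), (hs.mul ht).neg, ?_⟩
      have hdot : (Pi.single x s + Pi.single c t : κ → ℝ) ⬝ᵥ Pi.single c 1 = t := by
        simp [hxy.symm]
      rw [dotReflection_apply, hnorm, hdot, smul_add, ← Pi.single_smul, ← Pi.single_smul]
      norm_num [htt, Pi.single_neg, mul_comm]
    · refine ⟨c, 1, by simp [IsSign], ?_⟩
      have hdot : (Pi.single x s + Pi.single y t : κ → ℝ) ⬝ᵥ Pi.single c 1 = 0 := by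
        simp [hcx, hcy]
      rw [dotReflection_apply, hdot, mul_zero, zero_smul, sub_zero]

variable {ι M N : Type*} [Fintype ι] [AddCommGroup M] [Module ℝ M] [AddCommGroup N] [Module ℝ N]
  {P : RootPairing ι ℝ M N}

lemma linearIndependent_coroot {k : ℕ} {γ : Fin k → ι} [P.IsRootSystem]
    (h : LinearIndependent ℝ fun i => P.root (γ i)) :
    LinearIndependent ℝ fun i => P.coroot (γ i) := by
  have hker : LinearMap.ker P.Polarization = ⊥ := by
    rw [P.ker_polarization_eq_ker_rootForm]
    exact LinearMap.separatingLeft_iff_ker_eq_bot.1 P.rootForm_nondegenerate.1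
  have hcoroot : ∀ i, P.coroot (γ i) =
      (2 / P.RootForm (P.root (γ i)) (P.root (γ i))) • P.Polarization (P.root (γ i)) := by
    intro i
    have hne : P.RootForm (P.root (γ i)) (P.root (γ i)) ≠ 0 := (rootForm_root_self_pos _).ne'
    refine smul_right_injective N hne ?_
    have := P.rootForm_self_smul_coroot (γ i)
    rw [← Nat.cast_smul_eq_nsmul ℝ] at this
    simp only [this, smul_smul, mul_div_cancel₀ _ hne]
    norm_num
  rw [Fintype.linearIndependent_iff]
  intro c hc i
  simp only [hcoroot, smul_smul] at hc
  have h0 := Fintype.linearIndependent_iff.1 (h.map' P.Polarization hker) _ hc i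
  exact (mul_eq_zero.1 h0).resolve_right
    (div_ne_zero two_ne_zero (rootForm_root_self_pos _).ne')

/-- If the simple coroots are represented, as far as the Cartan integers are concerned, by vectors
`±e_a ± e_b`, `±e_a`, `±2e_a`, then all coroots are represented by such vectors, and linear
independence of roots implies linear independence of their coroots modulo every odd number. -/
lemma isIndependentMod_of_isShortSum [P.IsRootSystem] [P.IsCrystallographic] [P.IsReduced]
    (b : P.Base) {κ : Type*} [Fintype κ] [DecidableEq κ] (a : b.support → κ → ℝ)
    (ha : ∀ i, IsShortSum (a i)) (ha0 : ∀ i, a i ≠ 0)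
    (hrel : ∀ i j : b.support, P.pairing j i * (a j ⬝ᵥ a j) = 2 * (a j ⬝ᵥ a i))
    {m : ℕ} (hm : Odd m) {k : ℕ} {γ : Fin k → ι}
    (hγ : LinearIndependent ℝ fun i => P.root (γ i)) : IsIndependentMod P m γ := by
  set F : N →ₗ[ℝ] (κ → ℝ) := b.toCoweightBasis.constr ℝ a with hF
  have hFb : ∀ i : b.support, F (P.coroot i) = a i := fun i => by
    rw [hF, ← b.toCoweightBasis_apply, Basis.constr_basis]
  have hequi : ∀ (j : b.support) (y : N), F (P.coreflection j y) = dotReflection (a j) (F y) := by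
    intro j y
    have : F ∘ₗ (P.coreflection j : N →ₗ[ℝ] N) = dotReflection (a j) ∘ₗ F := by
      refine b.toCoweightBasis.ext fun i => ?_
      have hne : a j ⬝ᵥ a j ≠ 0 := fun h => ha0 j (dotProduct_self_eq_zero.1 h)
      simp only [b.toCoweightBasis_apply, LinearMap.comp_apply, LinearEquiv.coe_coe,
        P.coreflection_apply_coroot, map_sub, map_smul, hFb, dotReflection_apply]
      congr 2
      rw [div_mul_eq_mul_div, ← hrel, mul_div_cancel_right₀ _ hne]
    exact LinearMap.congr_fun this y
  have hinj : LinearMap.ker F = ⊥ := by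
    rw [LinearMap.ker_eq_bot']
    intro y hy
    have h0 : ∀ j : b.support, P.toLinearMap (P.root j) y = 0 := by
      intro j
      have h1 := hequi j y
      rw [hy, map_zero, P.coreflection_apply, map_sub, map_smul, hy, hFb, zero_sub,
        neg_eq_zero] at h1
      exact (smul_eq_zero.1 h1).resolve_right (ha0 j)
    have h1 : P.flip.toPerfPair y = 0 := b.toWeightBasis.ext fun j => by
      simpa using h0 j
    exact (LinearEquiv.map_eq_zero_iff _).1 h1
  have hshort : ∀ i, IsShortSum (F (P.coroot i)) := by
    intro i
    refine b.induction_reflect i (p := fun i => IsShortSum (F (P.coroot i))) ?_ ?_ ?_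
    · intro i hi
      rw [P.coroot_reflectionPerm, P.coreflection_apply_self, map_neg]
      exact hi.neg
    · intro i hi
      rw [hFb ⟨i, hi⟩]
      exact ha _
    · intro i j hi hj
      rw [P.coroot_reflectionPerm, hequi ⟨j, hj⟩]
      exact ((ha _).isSignedMap_dotReflection (ha0 _)).isShortSum hi
  intro x y hy hxy
  refine dvd_of_sum_smul_eq_of_isShortSum hm (fun i => F (P.coroot (γ i))) (fun i => hshort _)
    ((linearIndependent_coroot hγ).map' F hinj) x (F y) ?_ ?_
  · clear hxy
    induction hy using Submodule.span_induction with
    | mem y hy =>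
      obtain ⟨i, rfl⟩ := hy
      exact (hshort i).isIntegral
    | zero => exact fun c => ⟨0, by simp⟩
    | add y y' _ _ hy hy' => rw [map_add]; exact hy.add hy'
    | smul c y _ hy =>
      rw [← Int.cast_smul_eq_zsmul ℝ, map_smul]
      exact hy.int_smul c
  · rw [← map_smul, ← hxy, map_sum]
    simp only [map_smul]

/-- The dot product of `s e_x + t e_y` and `s' e_{x'} + t' e_{y'}`. -/
def shortDot {κ : Type*} [DecidableEq κ] (x y x' y' : κ) (s t s' t' : ℤ) : ℤ :=
  (if x = x' then s * s' else 0) + (if x = y' then s * t' else 0) +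
    ((if y = x' then t * s' else 0) + (if y = y' then t * t' else 0))

lemma isIndependentMod_of_coordinates [P.IsRootSystem] [P.IsCrystallographic] [P.IsReduced]
    {b : P.Base} {n : ℕ} {e : Fin n ≃ b.support} {A : Matrix (Fin n) (Fin n) ℤ}
    (hA : HasCartanMatrix b e A) {κ : Type*} [Fintype κ] [DecidableEq κ] (x y : Fin n → κ)
    (s t : Fin n → ℤ) (hs : ∀ i, s i = -1 ∨ s i = 0 ∨ s i = 1)
    (ht : ∀ i, t i = -1 ∨ t i = 0 ∨ t i = 1)
    (hne : ∀ i, shortDot (x i) (y i) (x i) (y i) (s i) (t i) (s i) (t i) ≠ 0)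
    (hrel : ∀ i j, A j i * shortDot (x j) (y j) (x j) (y j) (s j) (t j) (s j) (t j) =
      2 * shortDot (x j) (y j) (x i) (y i) (s j) (t j) (s i) (t i))
    {m : ℕ} (hm : Odd m) {k : ℕ} {γ : Fin k → ι}
    (hγ : LinearIndependent ℝ fun i => P.root (γ i)) : IsIndependentMod P m γ := by
  have hdot : ∀ i j, (Pi.single (x i) (s i : ℝ) + Pi.single (y i) (t i : ℝ) : κ → ℝ) ⬝ᵥ
      (Pi.single (x j) (s j : ℝ) + Pi.single (y j) (t j : ℝ)) =
      (shortDot (x i) (y i) (x j) (y j) (s i) (t i) (s j) (t j) : ℤ) := by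
    intro i j
    rw [single_add_single_dotProduct, shortDot]
    push_cast
    rfl
  have hsign : ∀ z : ℤ, z = -1 ∨ z = 0 ∨ z = 1 → IsSign (z : ℝ) := by
    rintro z (rfl | rfl | rfl) <;> simp [IsSign]
  refine isIndependentMod_of_isShortSum b
    (fun i => Pi.single (x (e.symm i)) (s (e.symm i) : ℝ) +
      Pi.single (y (e.symm i)) (t (e.symm i) : ℝ))
    (fun i => ⟨_, _, _, _, hsign _ (hs _), hsign _ (ht _), rfl⟩) (fun i h => ?_) ?_ hm hγ
  · refine hne (e.symm i) ?_
    have := hdot (e.symm i) (e.symm i)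
    rw [h, zero_dotProduct] at this
    exact_mod_cast this.symm
  · intro i j
    rw [hdot, hdot, ← cast_cartanMatrix]
    have := hA (e.symm j) (e.symm i)
    rw [Equiv.apply_symm_apply, Equiv.apply_symm_apply] at this
    rw [this]
    exact_mod_cast hrel (e.symm i) (e.symm j)

/-- The index after `i`, or `i` itself if it is the last one. -/
def succOrLast {n : ℕ} (i : Fin n) : Fin n := if h : i.val + 1 < n then ⟨i + 1, h⟩ else i

/-- The index `i`, except that the last index is replaced by the one before it. -/
def selfOrPred {n : ℕ} (i : Fin n) : Fin n :=
  if i.val + 1 < n then i else ⟨i - 1, by omega⟩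

lemma val_succOrLast {n : ℕ} (i : Fin n) :
    (succOrLast i).val = if i.val + 1 < n then i.val + 1 else i.val := by
  unfold succOrLast
  split_ifs <;> rfl

lemma val_selfOrPred {n : ℕ} (i : Fin n) :
    (selfOrPred i).val = if i.val + 1 < n then i.val else i.val - 1 := by
  unfold selfOrPred
  split_ifs <;> rfl

/-- The simple coroots of the classical root systems are represented by `e_i - e_{i+1}` and, in the
last place, by `e_{n-1} - e_n`, `2e_{n-1}`, `e_{n-1}`, `e_{n-2} + e_{n-1}` for the types
`A`, `B`, `C`, `D` respectively. -/
lemma isIndependentMod_of_hasCartanMatrix [P.IsRootSystem] [P.IsCrystallographic] [P.IsReduced]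
    {b : P.Base} {n : ℕ} {e : Fin n ≃ b.support}
    (h : HasCartanMatrix b e (CartanMatrix.A n) ∨
      (2 ≤ n ∧ HasCartanMatrix b e (CartanMatrix.B n)) ∨
      (2 ≤ n ∧ HasCartanMatrix b e (CartanMatrix.C n)) ∨
      (4 ≤ n ∧ HasCartanMatrix b e (CartanMatrix.D n)))
    {m : ℕ} (hm : Odd m) {k : ℕ} {γ : Fin k → ι}
    (hγ : LinearIndependent ℝ fun i => P.root (γ i)) : IsIndependentMod P m γ := by
  rcases h with hA | ⟨hn, hA⟩ | ⟨hn, hA⟩ | ⟨hn, hA⟩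
  · refine isIndependentMod_of_coordinates hA Fin.castSucc Fin.succ (fun _ => 1) (fun _ => -1)
      (by simp) (by simp) (fun i => ?_) (fun i j => ?_) hm hγ
    · simp only [shortDot, Fin.ext_iff, Fin.val_succ, Fin.val_castSucc]
      grind
    · simp only [CartanMatrix.A, Matrix.of_apply, shortDot, Fin.ext_iff, Fin.val_succ,
        Fin.val_castSucc]
      grind
  · refine isIndependentMod_of_coordinates hA id succOrLast (fun _ => 1)
      (fun i => if i.val + 1 < n then -1 else 1)
      (by simp) (by grind) (fun i => ?_) (fun i j => ?_) hm hγ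
    · simp only [shortDot, id, Fin.ext_iff, val_succOrLast]
      grind
    · simp only [CartanMatrix.B, Matrix.of_apply, shortDot, id, Fin.ext_iff, val_succOrLast]
      grind
  · refine isIndependentMod_of_coordinates hA id succOrLast (fun _ => 1)
      (fun i => if i.val + 1 < n then -1 else 0)
      (by simp) (by grind) (fun i => ?_) (fun i j => ?_) hm hγ
    · simp only [shortDot, id, Fin.ext_iff, val_succOrLast]
      grind
    · simp only [CartanMatrix.C, Matrix.of_apply, shortDot, id, Fin.ext_iff, val_succOrLast]
      grind
  · refine isIndependentMod_of_coordinates hA selfOrPred succOrLast (fun _ => 1)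
      (fun i => if i.val + 1 < n then -1 else 1)
      (by simp) (by grind) (fun i => ?_) (fun i j => ?_) hm hγ
    · simp only [shortDot, Fin.ext_iff, val_succOrLast, val_selfOrPred]
      grind
    · simp only [CartanMatrix.D, Matrix.of_apply, shortDot, Fin.ext_iff, val_succOrLast,
        val_selfOrPred]
      by_cases hi : i.val + 1 < n <;> by_cases hj : j.val + 1 < n <;>
        simp only [hi, hj, if_true, if_false] <;> grind

/-- Symmetrizers with values `1` and `2` of the classical Cartan matrices. -/
lemma exists_classical_symmetrizer {n : ℕ} {A : Matrix (Fin n) (Fin n) ℤ}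
    (h : (1 ≤ n ∧ A = CartanMatrix.A n) ∨ (2 ≤ n ∧ A = CartanMatrix.B n) ∨
      (2 ≤ n ∧ A = CartanMatrix.C n) ∨ (4 ≤ n ∧ A = CartanMatrix.D n)) :
    ∃ δ : Fin n → ℕ, (∀ i, δ i = 1 ∨ δ i = 2) ∧ (∃ i, δ i = 1) ∧
      ∀ i j, (δ i : ℤ) * A j i = δ j * A i j := by
  rcases h with ⟨hn, rfl⟩ | ⟨hn, rfl⟩ | ⟨hn, rfl⟩ | ⟨hn, rfl⟩
  · refine ⟨fun _ => 1, by simp, ⟨⟨0, by omega⟩, rfl⟩, fun i j => ?_⟩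
    simp only [CartanMatrix.A, Matrix.of_apply, Fin.ext_iff]
    grind
  · refine ⟨fun i => if i.val + 1 < n then 2 else 1, by grind, ⟨⟨n - 1, by omega⟩, by grind⟩,
      fun i j => ?_⟩
    simp only [CartanMatrix.B, Matrix.of_apply, Fin.ext_iff]
    grind
  · refine ⟨fun i => if i.val + 1 < n then 1 else 2, by grind, ⟨⟨0, by omega⟩, by grind⟩,
      fun i j => ?_⟩
    simp only [CartanMatrix.C, Matrix.of_apply, Fin.ext_iff]
    grind
  · refine ⟨fun _ => 1, by simp, ⟨⟨0, by omega⟩, rfl⟩, fun i j => ?_⟩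
    simp only [CartanMatrix.D, Matrix.of_apply, Fin.ext_iff]
    grind

end Classical

/-! ### Dual systems from integral matrices -/

section ExceptionalTypes

variable {ι M N : Type*} [Fintype ι] [AddCommGroup M] [Module ℝ M] [AddCommGroup N] [Module ℝ N]
  {P : RootPairing ι ℝ M N}

/-- If the numbers `δ` symmetrize the Cartan matrix and have the value `1`, they give the squared
lengths of the simple roots in the unit in which the coprime symmetrizer `d` of any other base
does so. -/
lemma IsSymmetrizer.exists_common_isLengthScale [P.IsCrystallographic] [P.IsReduced]
    [P.IsIrreducible] {b b' : P.Base} {d : b.support → ℕ} (hd : IsSymmetrizer b d) {n : ℕ}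
    {e : Fin n ≃ b'.support}
    {A : Matrix (Fin n) (Fin n) ℤ} (hA : HasCartanMatrix b' e A) {δ : Fin n → ℕ}
    (hpos : ∀ i, 0 < δ i) (hone : ∃ i, δ i = 1)
    (hsymm : ∀ i j, (δ i : ℤ) * A j i = δ j * A i j) :
    ∃ c, 0 < c ∧ IsLengthScale b d c ∧ IsLengthScale b' (δ ∘ e.symm) c := by
  obtain ⟨i₀, hi₀⟩ := hone
  have : Nonempty ι := ⟨(e i₀ : ι)⟩
  obtain ⟨j₀, hj₀⟩ := b.support_nonempty
  obtain ⟨c, hc, hbc⟩ := exists_isLengthScale b hd.pos hd.symm ⟨j₀, hj₀⟩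
  obtain ⟨c', -, hbc'⟩ := exists_isLengthScale b' (d := δ ∘ e.symm) (fun i => hpos _)
    (fun i j => by
      have h := hsymm (e.symm i) (e.symm j)
      rw [← hA, ← hA, Equiv.apply_symm_apply, Equiv.apply_symm_apply] at h
      exact h) (e i₀)
  have hcc := hd.lengthScale_unique hc hbc hbc' (i' := e i₀) (by simpa using hi₀)
  exact ⟨c, hc, hbc, hcc ▸ hbc'⟩

lemma IsLengthScale.exists_rootForm_eq [P.IsCrystallographic] [P.IsReduced] {b : P.Base} {n : ℕ}
    {e : Fin n ≃ b.support} {δ : Fin n → ℕ} {c : ℝ} (h : IsLengthScale b (δ ∘ e.symm) c) (i : ι) :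
    ∃ j, P.RootForm (P.root i) (P.root i) = c * δ j := by
  obtain ⟨j, hj⟩ := exists_mem_support_rootForm_eq b i
  exact ⟨e.symm j, by rw [hj, h]; rfl⟩

/-- A dual system for roots `β_t = ∑ B_{tj} α_j` arises from integral vectors `H_a` whose products
with the vectors `(δ_j B_{tj})_j` form a diagonal matrix with entries prime to `m`. The vector
`(δ_j B_{tj})_j` consists of the coordinates of the multiple of `β_t^∨` by the squared length of
`β_t`; hence this squared length divides the diagonal entry. -/
lemma exists_dualSystem [P.IsRootSystem] {b : P.Base} {δ : b.support → ℕ} {c : ℝ} (hc : 0 < c)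
    (hbc : IsLengthScale b δ c) {k : ℕ} {β : Fin k → ι} {r : Fin k → ℕ} (hr0 : ∀ t, r t ≠ 0)
    (hr : ∀ t, P.RootForm (P.root (β t)) (P.root (β t)) = c * r t) {B H : Fin k → b.support → ℤ}
    (hB : ∀ t, P.root (β t) = ∑ j, (B t j : ℝ) • P.root j) {D : Fin k → ℤ}
    (hH : ∀ a t, ∑ j, H a j * (δ j * B t j) = if a = t then D a else 0)
    (hD0 : ∀ a, D a ≠ 0) {m : ℕ} (hDm : ∀ a, IsCoprime (D a) (m : ℤ)) :
    Nonempty (DualSystem P m β) ∧ ∀ t, (r t : ℤ) ∣ D t := by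
  choose f hf using fun a => exists_coweight_of_base b fun j => ((H a j * δ j : ℤ) : ℝ)
  choose x hx using fun a => exists_weight_of_base b fun j => ((H a j : ℤ) : ℝ)
  have hxint : ∀ a i, ∃ z : ℤ, P.toLinearMap (x a) (P.coroot i) = z := fun a =>
    exists_int_coroot_of_base fun j => ⟨_, hx a j⟩
  have hfβ : ∀ a t, P.toLinearMap (P.root (β t)) (f a) = if a = t then (D a : ℝ) else 0 := by
    intro a t
    have h := congrArg (Int.cast : ℤ → ℝ) (hH a t)
    push_cast at h
    rw [hB, map_sum, LinearMap.sum_apply, ← h]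
    refine Finset.sum_congr rfl fun j _ => ?_
    rw [map_smul, LinearMap.smul_apply, hf, smul_eq_mul]
    push_cast
    ring
  have hxβ : ∀ a t, (r t : ℝ) * P.toLinearMap (x a) (P.coroot (β t)) =
      if a = t then (D a : ℝ) else 0 := by
    intro a t
    have h := congrArg (Int.cast : ℤ → ℝ) (hH a t)
    push_cast at h
    have h' := congrArg (P.toLinearMap (x a)) (smul_coroot_eq_sum hc hbc (hr t) (hB t))
    rw [map_smul, smul_eq_mul] at h'
    rw [h', map_sum, ← h]
    refine Finset.sum_congr rfl fun j _ => ?_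
    rw [map_smul, hx, smul_eq_mul, mul_comm]
  choose z hz using fun a => hxint a (β a)
  have hrz : ∀ a, (r a : ℤ) * z a = D a := by
    intro a
    have h := hxβ a a
    rw [hz, if_pos rfl] at h
    exact_mod_cast h
  refine ⟨⟨{ coweight := f
             weight := x
             coweightValue := D
             weightValue := z
             coweight_int := fun a => exists_int_of_base fun j => ⟨_, hf a j⟩
             weight_int := hxint
             coweight_apply := hfβ
             weight_apply := fun a t => ?_
             coweightValue_ne_zero := hD0
             weightValue_ne_zero := fun a h => hD0 a (by rw [← hrz, h, mul_zero])
             isCoprime_coweightValue := hDm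
             isCoprime_weightValue := fun a => ?_ }⟩, fun t => ⟨z t, (hrz t).symm⟩⟩
  · split_ifs with hat
    · rw [← hat, hz]
    · have h := hxβ a t
      rw [if_neg hat] at h
      exact (mul_eq_zero.1 h).resolve_left (by exact_mod_cast hr0 t)
  · have h := hDm a
    rw [← hrz] at h
    exact h.of_mul_left_right

/-! ### Evaluation of the tables -/

/-- The sum of the products of corresponding entries. -/
def listDot : List ℤ → List ℤ → ℤ
  | x :: h, y :: g => x * y + listDot h g
  | _, _ => 0

/-- The integer divides a high power of `2q`; so it is nonzero, and is prime to every number that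
is prime to `2q`. -/
def DividesPower (q : ℕ) (z : ℤ) : Bool := decide (z.natAbs ∣ (2 * q) ^ 32)

/-- The combination of `h` and `p` whose product with `g` is zero. -/
def eliminateFrom (g p h : List ℤ) : List ℤ :=
  if listDot h g = 0 then h
  else List.zipWith (fun a b => listDot p g * a - listDot h g * b) h p

/-- The first element satisfying `f`, and the list of the other ones. -/
def extractFirst (f : List ℤ → Bool) : List (List ℤ) → Option (List ℤ × List (List ℤ))
  | [] => none
  | h :: hs => bif f h then some (h, hs) else (extractFirst f hs).map fun x => (x.1, h :: x.2)

/-- Elimination: vectors whose matrix of products with the given vectors is diagonal.  The pivots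
are chosen among the divisors of powers of `2q`.  No property of the procedure is relied upon: its
result is checked by `IsDualFamily`. -/
def dualFamily (q : ℕ) : List (List ℤ) → List (List ℤ) → List (List ℤ) → List (List ℤ)
  | [], done, _ => done
  | g :: gs, done, rest =>
    match extractFirst (fun h => DividesPower q (listDot h g)) rest with
    | none => []
    | some (p, rest') =>
      dualFamily q gs (done.map (eliminateFrom g p) ++ [p]) (rest'.map (eliminateFrom g p))

/-- The standard basis of `ℤⁿ`. -/
def standardBasis (n : ℕ) : List (List ℤ) :=
  (List.range n).map fun i => (List.range n).map fun j => bif i == j then 1 else 0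

/-- The matrix of products of `hs` and `vs` is diagonal, and its diagonal entries divide powers of
`2q`. -/
def IsDualFamily (q : ℕ) (vs hs : List (List ℤ)) : Bool :=
  (List.range vs.length).all fun a => (List.range vs.length).all fun t =>
    bif a == t then DividesPower q (listDot (hs.getD a []) (vs.getD t []))
    else listDot (hs.getD a []) (vs.getD t []) == 0

/-- The coordinates, with respect to the simple coroots, of the multiple of the coroot number `k` by
the squared length of the root, where `δ` are the squared lengths of the simple roots. -/
def ExceptionalTable.corootCoeffs (T : ExceptionalTable) (δ : List ℕ) (k : ℕ) : List ℤ :=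
  List.zipWith (fun d a => ((d * a : ℕ) : ℤ)) δ (T.roots.getD (k - 1) [])

/-- The check performed on a line of a table: elimination exhibits the independence of the coroots
modulo every number that is prime to `2q`, and moreover either the squared lengths of all roots
are prime to such a number, or there is only one root. -/
def TableRow.IsCertified (T : ExceptionalTable) (δ : List ℕ) (r : TableRow) : Bool :=
  let q := r.q.getD 1
  let vs := (r.first ++ r.second).map (T.corootCoeffs δ)
  (q == 1 || q == 3 || q == 5) && (δ.all (fun d => DividesPower q d) || decide (vs.length ≤ 1)) &&
    IsDualFamily q vs (dualFamily q vs [] (standardBasis T.rank))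

/-- The numbers `δ` are the squared lengths of the simple roots, the shortest having length `1`, and
all lines of the table pass the check. -/
structure ExceptionalTable.IsCertified (T : ExceptionalTable) (δ : List ℕ) : Prop where
  length_eq : δ.length = T.rank
  pos : ∀ i : Fin T.rank, 0 < δ.getD i 0
  exists_eq_one : ∃ i : Fin T.rank, δ.getD i 0 = 1
  symm : ∀ i j : Fin T.rank, (δ.getD i 0 : ℤ) * T.cartan j i = δ.getD j 0 * T.cartan i j
  rows : ∀ r ∈ T.rows, r.IsCertified T δ = true

lemma isCertified_tableG₂ : tableG₂.IsCertified [1, 3] := by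
  constructor <;> decide +kernel

lemma isCertified_tableF₄ : tableF₄.IsCertified [2, 2, 1, 1] := by
  constructor <;> decide +kernel

lemma isCertified_tableE₆ : tableE₆.IsCertified [1, 1, 1, 1, 1, 1] := by
  constructor <;> decide +kernel

lemma isCertified_tableE₇ : tableE₇.IsCertified [1, 1, 1, 1, 1, 1, 1] := by
  constructor <;> decide +kernel

lemma isCertified_tableE₈ : tableE₈.IsCertified [1, 1, 1, 1, 1, 1, 1, 1] := by
  constructor <;> decide +kernel

lemma exists_isCertified {T : ExceptionalTable} (hT : T ∈ exceptionalTables) :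
    ∃ δ, T.IsCertified δ := by
  simp only [exceptionalTables, List.mem_cons, List.not_mem_nil, or_false] at hT
  rcases hT with rfl | rfl | rfl | rfl | rfl
  exacts [⟨_, isCertified_tableG₂⟩, ⟨_, isCertified_tableF₄⟩, ⟨_, isCertified_tableE₆⟩,
    ⟨_, isCertified_tableE₇⟩, ⟨_, isCertified_tableE₈⟩]

lemma listDot_zipWith (δ g : List ℕ) (h : List ℤ) :
    ∀ {n : ℕ}, δ.length = n → listDot h (List.zipWith (fun d a => ((d * a : ℕ) : ℤ)) δ g) =
      ∑ j : Fin n, h.getD j 0 * (δ.getD j 0 * g.getD j 0 : ℕ) := by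
  induction δ generalizing g h with
  | nil =>
    rintro _ rfl
    cases h <;> simp [listDot]
  | cons d δ ih =>
    rintro _ rfl
    rw [List.length_cons, Fin.sum_univ_succ]
    cases g with
    | nil => cases h <;> simp [listDot]
    | cons a g =>
      cases h with
      | nil => simp [listDot]
      | cons x h =>
        rw [List.zipWith_cons_cons, listDot, ih g h rfl]
        simp

lemma DividesPower.ne_zero {q : ℕ} (hq : q ≠ 0) {z : ℤ} (h : DividesPower q z = true) : z ≠ 0 := by
  rintro rfl
  have h' : (0 : ℤ).natAbs ∣ (2 * q) ^ 32 := of_decide_eq_true h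
  rw [Int.natAbs_zero, zero_dvd_iff] at h'
  exact pow_ne_zero _ (mul_ne_zero two_ne_zero hq) h'

lemma DividesPower.isCoprime {q m : ℕ} (hqm : Nat.Coprime (2 * q) m) {z : ℤ}
    (h : DividesPower q z = true) : IsCoprime z (m : ℤ) := by
  have h' : z.natAbs ∣ (2 * q) ^ 32 := of_decide_eq_true h
  rw [Int.isCoprime_iff_gcd_eq_one]
  exact (hqm.pow_left 32).coprime_dvd_left h'

/-- The information on a line of a table that the check provides. -/
lemma TableRow.IsCertified.exists_dual {T : ExceptionalTable} {δ : List ℕ}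
    (hδ : δ.length = T.rank) {r : TableRow} (h : r.IsCertified T δ = true) {m : ℕ} (hm : Odd m)
    (hqm : ∀ k ∈ r.q, ¬ k ∣ m) :
    ((∀ j : Fin T.rank, (δ.getD j 0).Coprime m) ∨ (r.first ++ r.second).length ≤ 1) ∧
    ∃ (H : ℕ → Fin T.rank → ℤ) (D : ℕ → ℤ), (∀ a < (r.first ++ r.second).length,
      D a ≠ 0 ∧ IsCoprime (D a) (m : ℤ)) ∧
      ∀ a t : ℕ, a < (r.first ++ r.second).length → ∀ ht : t < (r.first ++ r.second).length,
        ∑ j, H a j * (δ.getD j 0 * T.coeff ((r.first ++ r.second)[t]) j) =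
          if a = t then D a else 0 := by
  simp only [TableRow.IsCertified, Bool.and_eq_true, Bool.or_eq_true, beq_iff_eq,
    decide_eq_true_eq, List.length_map, List.all_eq_true] at h
  obtain ⟨⟨hq, hlen⟩, hdual⟩ := h
  set q := r.q.getD 1 with hqdef
  set ks := r.first ++ r.second
  have hq0 : q ≠ 0 := by omega
  have hqm' : Nat.Coprime (2 * q) m := by
    refine Nat.Coprime.mul_left (Nat.coprime_two_left.2 hm) ?_
    rcases hrq : r.q with _ | p
    · rw [hqdef, hrq]
      exact Nat.coprime_one_left m
    · have hp : q = p := by rw [hqdef, hrq]; rfl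
      have hdvd : ¬ q ∣ m := hp ▸ hqm p (by rw [hrq]; rfl)
      rcases hq with (hq | hq) | hq
      · rw [hq]
        exact Nat.coprime_one_left m
      · rw [hq] at hdvd ⊢
        exact (Nat.Prime.coprime_iff_not_dvd (by norm_num)).2 hdvd
      · rw [hq] at hdvd ⊢
        exact (Nat.Prime.coprime_iff_not_dvd (by norm_num)).2 hdvd
  refine ⟨hlen.imp (fun hall j => ?_) id, ?_⟩
  · have hj : j.val < δ.length := by rw [hδ]; exact j.isLt
    have := DividesPower.isCoprime hqm' (hall _ (List.getElem_mem hj))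
    rw [List.getD_eq_getElem _ _ hj]
    exact Nat.isCoprime_iff_coprime.1 this
  · set hs := dualFamily q (ks.map (T.corootCoeffs δ)) [] (standardBasis T.rank)
    simp only [IsDualFamily, List.length_map, List.all_eq_true, List.mem_range] at hdual
    refine ⟨fun a j => (hs.getD a []).getD j 0,
      fun a => listDot (hs.getD a []) ((ks.map (T.corootCoeffs δ)).getD a []), fun a ha => ?_,
      fun a t ha ht => ?_⟩
    · have h := hdual a ha a ha
      rw [beq_self_eq_true, cond_true] at h
      exact ⟨DividesPower.ne_zero hq0 h, DividesPower.isCoprime hqm' h⟩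
    · have hdot : listDot (hs.getD a []) ((ks.map (T.corootCoeffs δ)).getD t []) =
          ∑ j : Fin T.rank, (hs.getD a []).getD j 0 *
            (δ.getD j 0 * T.coeff (ks[t]) j) := by
        have hmap : (ks.map (T.corootCoeffs δ)).getD t [] = T.corootCoeffs δ ks[t] := by
          rw [List.getD_eq_getElem _ _ (by simpa using ht), List.getElem_map]
        rw [hmap, ExceptionalTable.corootCoeffs, listDot_zipWith _ _ _ hδ]
        simp only [Nat.cast_mul]
        rfl
      rw [← hdot]
      have h := hdual a ha t ht
      split_ifs with hat
      · rw [hat]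
      · rw [beq_eq_false_iff_ne.2 hat, cond_false] at h
        exact beq_iff_eq.1 h

/-! ### Linear independence modulo `m` for the exceptional types -/

/-- For an element `s` of a class listed in a table, the coroots of every presentation of `s` are
linearly independent modulo `m`, and the squared lengths of the roots are prime to `m`. -/
lemma InClassOfRow.isIndependentMod [P.IsRootSystem] [P.IsCrystallographic] [P.IsReduced]
    [P.IsIrreducible] {b : P.Base} {d : b.support → ℕ} (hd : IsSymmetrizer b d)
    {T : ExceptionalTable} {δ : List ℕ} (hT : T.IsCertified δ) {r : TableRow} (hrT : r ∈ T.rows)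
    {s : M ≃ₗ[ℝ] M} (hs : InClassOfRow P T r s) {m : ℕ} (hm : Odd m)
    (hqm : ∀ k ∈ r.q, ¬ k ∣ m) {l n : ℕ} {γ : Fin l → ι} (hγ : IsInvolutionPresentation P s n γ) :
    IsIndependentMod P m γ ∧ ∃ (c : ℝ) (ρ : Fin l → ℕ), 0 < c ∧ IsLengthScale b d c ∧
      ∀ i, P.RootForm (P.root (γ i)) (P.root (γ i)) = c * ρ i ∧ (ρ i).Coprime m := by
  obtain ⟨b', e, hA, β, hβ, w, hw, rfl⟩ := hs
  obtain ⟨hlen, H, D, hD, hHD⟩ := TableRow.IsCertified.exists_dual hT.length_eq (hT.rows r hrT)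
    hm hqm
  obtain ⟨c, hc, hbc, hbc'⟩ := hd.exists_common_isLengthScale hA hT.pos hT.exists_eq_one hT.symm
  choose J hJ using fun i => hbc'.exists_rootForm_eq i
  have hk : (r.first ++ r.second).length = β.length := hβ.length_eq
  have hlt : ∀ t : Fin β.length, t.val < (r.first ++ r.second).length := fun t => by
    rw [hk]
    exact t.isLt
  obtain ⟨⟨E⟩, hdvd⟩ := exists_dualSystem hc hbc' (β := β.get)
    (r := fun t => δ.getD (J (β.get t)) 0) (fun t => (hT.pos _).ne') (fun t => hJ _)
    (B := fun t j => T.coeff ((r.first ++ r.second)[t.val]'(hlt t)) (e.symm j))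
    (H := fun a j => H a (e.symm j)) (D := fun a => D a)
    (fun t => by
      have h := hβ.get (hlt t) t.isLt
      rw [← Equiv.sum_comp e]
      simpa [← Nat.cast_smul_eq_nsmul ℝ] using h)
    (fun a t => by
      have h := hHD a t (hlt a) (hlt t)
      rw [← Equiv.sum_comp e]
      simpa [Fin.ext_iff] using h)
    (fun a => (hD a (hlt a)).1) (fun a => (hD a (hlt a)).2)
  obtain ⟨g, rfl⟩ := exists_aut_of_mem_weylGroup hw
  have hprod : RootPairing.Equiv.weightEquiv P P g * (β.map P.reflection).prod *
      (RootPairing.Equiv.weightEquiv P P g)⁻¹ = reflectionProd P (g.indexEquiv ∘ β.get) := by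
    rw [reflectionProd_indexEquiv, reflectionProd]
    congr 3
    exact (List.ofFn_getElem_eq_map β P.reflection).symm
  rw [hprod] at hγ
  obtain rfl := (E.map g).card_eq hγ
  refine ⟨(E.map g).isIndependentMod (by rw [hγ.prod_eq, firstFactor_mul_secondFactor]), c, ?_⟩
  rcases hlen with hcop | hone
  · exact ⟨fun i => δ.getD (J (γ i)) 0, hc, hbc, fun i => ⟨hJ _, hcop _⟩⟩
  · -- a single root: it is the root of the table up to the Weyl group and the sign
    refine ⟨fun i => δ.getD (J (β.get i)) 0, hc, hbc, fun i => ⟨?_, ?_⟩⟩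
    · have hsub : Subsingleton (Fin β.length) :=
        Fin.subsingleton_iff_le_one.2 (by rw [← hk]; exact hone)
      have hmem : P.root (γ i) ∈ Submodule.span ℝ {P.root (g.indexEquiv (β.get i))} := by
        have hrange : Set.range (fun t => P.root ((g.indexEquiv ∘ β.get) t)) =
            {P.root (g.indexEquiv (β.get i))} := by
          ext y
          constructor
          · rintro ⟨t, rfl⟩
            rw [Subsingleton.elim t i]
            rfl
          · rintro rfl
            exact ⟨i, rfl⟩
        rw [← hrange, (E.map g).span_eq_movedSpace, ← hγ.span_eq]
        exact Submodule.subset_span ⟨i, rfl⟩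
      obtain ⟨y, hy⟩ := Submodule.mem_span_singleton.1 hmem
      have hdep : ¬ LinearIndependent ℝ ![P.root (γ i), P.root (g.indexEquiv (β.get i))] := by
        rw [LinearIndependent.pair_iff]
        intro h
        have := (h 1 (-y) (by rw [← hy, one_smul, neg_smul, add_neg_cancel])).1
        exact one_ne_zero this
      have hlength : P.RootForm (P.root (γ i)) (P.root (γ i)) =
          P.RootForm (P.root (β.get i)) (P.root (β.get i)) := by
        rcases RootPairing.IsReduced.eq_or_eq_neg _ _ hdep with h | h
        · rw [h, root_indexEquiv, rootForm_weightEquiv]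
        · rw [h, root_indexEquiv]
          simp only [map_neg, LinearMap.neg_apply, neg_neg]
          rw [rootForm_weightEquiv]
      rw [hlength, hJ]
    · have h := (hD i (hlt i)).2.of_isCoprime_of_dvd_left (hdvd i)
      exact Nat.isCoprime_iff_coprime.1 h

end ExceptionalTypes

/-! ### The identity and the classical types -/

section Conclusion

variable {ι M N : Type*} [Fintype ι] [AddCommGroup M] [Module ℝ M] [AddCommGroup N] [Module ℝ N]
  {P : RootPairing ι ℝ M N}

/-- The orthogonal complement of the space fixed by the identity contains no roots. -/
lemma IsInvolutionPresentation.isEmpty_of_one [P.IsCrystallographic] {l n : ℕ} {γ : Fin l → ι}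
    (hγ : IsInvolutionPresentation P 1 n γ) : IsEmpty (Fin l) := by
  refine ⟨fun i => (rootForm_root_self_pos (P := P) (γ i)).ne' ?_⟩
  have hmem : P.root (γ i) ∈ movedSpace P 1 := hγ.span_eq ▸ Submodule.subset_span ⟨i, rfl⟩
  exact hmem _ rfl

/-- For the classical types the squared lengths of all roots, in the unit given by the coprime
symmetrizer, are `1` or `2`; so they are prime to an odd `m`. -/
lemma IsClassical.isIndependentMod_and_coprime [P.IsRootSystem] [P.IsCrystallographic]
    [P.IsReduced] [P.IsIrreducible] (h : IsClassical P) {b : P.Base} {d : b.support → ℕ}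
    (hd : IsSymmetrizer b d) {m : ℕ} (hm : Odd m) {l : ℕ} {γ : Fin l → ι}
    (hγ : LinearIndependent ℝ fun i => P.root (γ i)) :
    IsIndependentMod P m γ ∧ ∃ (c : ℝ) (ρ : Fin l → ℕ), 0 < c ∧ IsLengthScale b d c ∧
      ∀ i, P.RootForm (P.root (γ i)) (P.root (γ i)) = c * ρ i ∧ (ρ i).Coprime m := by
  obtain ⟨b', n, e, hA⟩ := h
  refine ⟨isIndependentMod_of_hasCartanMatrix (hA.imp_left And.right) hm hγ, ?_⟩
  obtain ⟨A, hA, hAe⟩ : ∃ A, ((1 ≤ n ∧ A = CartanMatrix.A n) ∨ (2 ≤ n ∧ A = CartanMatrix.B n) ∨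
      (2 ≤ n ∧ A = CartanMatrix.C n) ∨ (4 ≤ n ∧ A = CartanMatrix.D n)) ∧
      HasCartanMatrix b' e A := by
    rcases hA with ⟨hn, hA⟩ | ⟨hn, hA⟩ | ⟨hn, hA⟩ | ⟨hn, hA⟩
    exacts [⟨_, Or.inl ⟨hn, rfl⟩, hA⟩, ⟨_, Or.inr (Or.inl ⟨hn, rfl⟩), hA⟩,
      ⟨_, Or.inr (Or.inr (Or.inl ⟨hn, rfl⟩)), hA⟩, ⟨_, Or.inr (Or.inr (Or.inr ⟨hn, rfl⟩)), hA⟩]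
  obtain ⟨δ, hδ, hone, hsymm⟩ := exists_classical_symmetrizer hA
  obtain ⟨c, hc, hbc, hbc'⟩ := hd.exists_common_isLengthScale hAe
    (fun i => by rcases hδ i with h | h <;> rw [h] <;> norm_num) hone hsymm
  choose J hJ using fun i => hbc'.exists_rootForm_eq i
  refine ⟨c, fun i => δ (J (γ i)), hc, hbc, fun i => ⟨hJ _, ?_⟩⟩
  change (δ (J (γ i))).Coprime m
  rcases hδ (J (γ i)) with h | h <;> rw [h]
  · exact Nat.coprime_one_left m
  · exact Nat.coprime_two_left.2 hm

end Conclusion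

end TransversalSlices

open TransversalSlices in
/-- Let `P` be an irreducible root system, `b` the base of a system of positive roots associated to
the Weyl group element `s`, `q` the number attached to `s`, and `m` an odd positive integer not
divisible by `q` if `q` is defined.  Then for any integers `p_j` the only possible solution of
`Y_j(∑ m_i γ_i) = m p_j` in integers `|m_i| < m` is the trivial one. -/
theorem proposition6p1 {ι M N : Type*} [Fintype ι] [AddCommGroup M] [Module ℝ M]
    [AddCommGroup N] [Module ℝ N] (P : RootPairing ι ℝ M N)
    [P.IsRootSystem] [P.IsCrystallographic] [P.IsReduced] [P.IsIrreducible]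
    (s : M ≃ₗ[ℝ] M) (b : P.Base) (hb : IsAssociatedBase P s b)
    (q : Option ℕ) (hq : TableEntry P s q)
    (l' n : ℕ) (γ : Fin l' → ι) (hγ : IsInvolutionPresentation P s n γ)
    (d : b.support → ℕ) (hd : IsSymmetrizer b d)
    (m : ℕ) (hm : Odd m) (hqm : ∀ k ∈ q, ¬ k ∣ m)
    (p : b.support → ℤ) (c : Fin l' → ℤ)
    (hc : ∀ i, c i ∈ Set.Icc (-(m : ℤ) + 1) (m - 1))
    (hsys : ∀ j, Y b d j (∑ i, (c i : ℝ) • P.root (γ i)) = (m : ℝ) * (p j : ℝ)) :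
    ∀ i, c i = 0 := by
  intro i
  obtain ⟨hind, r, ρ, hr, hdr, hρ⟩ : IsIndependentMod P m γ ∧ ∃ (r : ℝ) (ρ : Fin l' → ℕ),
      0 < r ∧ IsLengthScale b d r ∧
      ∀ i, P.RootForm (P.root (γ i)) (P.root (γ i)) = r * ρ i ∧ (ρ i).Coprime m := by
    cases hq with
    | classical _ h => exact h.isIndependentMod_and_coprime hd hm hγ.linearIndependent
    | identity => exact (hγ.isEmpty_of_one.false i).elim
    | exceptional T r _ hT hr hs =>
      obtain ⟨δ, hδ⟩ := exists_isCertified hT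
      exact hs.isIndependentMod hd hδ hr hm hqm hγ
  exact eq_zero_of_isIndependentMod hr hdr hind (fun i => (hρ i).1) (fun i => (hρ i).2) hc hsys i
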